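/- Throughout, graphs are finite and simple. For a graph $G$ and $X,W\subseteq V(G)$ write $N_G(X,W)=\big(\bigcup_{v\in X}N_G(v)\setminus X\big)\cap W$, and for a real number $d>0$ say that $G$ $d$-expands into $W$ if (i) $|N_G(X,W)|\ge d|X|$ for all $X\subseteq V(G)$ with $1\le |X|<\lceil |W|/(2d)\rceil$, and (ii) there is at least one edge of $G$ between $X$ and $Y$ for all disjoint $X,Y\subseteq V(G)$ with $|X|=|Y|=\lceil |W|/(2d)\rceil$. Theorem (Path-cover). There exists an absolute constant $C>0$ such that for every integer $\ell\ge 200$ there is an $n_0=n_0(\ell)$ such that the following holds for every integer $n\ge n_0$ with $\ell\mid n$. Let $G$ be an $n$-vertex graph, let $(x_i,y_i)$, $1\le i\le n/\ell$, be pairwise disjoint pairs of vertices of $G$ (so the $2n/\ell$ vertices $x_i,y_i$ are all distinct), and let $W=V(G)\setminus\bigcup_i\{x_i,y_i\}$. If $G$ $d$-expands into $W$ with $d=C\ell\sqrt n$, then there are pairwise vertex-disjoint paths $P_1,\dots,P_{n/\ell}$ in $G$ which together cover all of $V(G)$, such that each $P_i$ is an $(x_i,y_i)$-path with exactly $\ell-1$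 edges. -/

import Mathlib

namespace SimpleGraph

variable {V : Type*} [Fintype V] [DecidableEq V]

/-- The external neighbourhood `N_G(X)` of a vertex set `X`: the union of the neighbourhoods of the
vertices of `X`, with `X` itself removed. -/
def extNeighborFinset (G : SimpleGraph V) [DecidableRel G.Adj] (X : Finset V) : Finset V :=
  X.biUnion (fun v => G.neighborFinset v) \ X

/-- `G` `d`-expands into `W`: small nonempty sets `X` satisfy `|N_G(X) ∩ W| ≥ d |X|`, and there is
an edge between any two disjoint vertex sets of size exactly `⌈|W| / (2d)⌉`. -/
structure ExpandsInto (G : SimpleGraph V) [DecidableRel G.Adj] (d : ℝ) (W : Finset V) : Prop where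
  expand : ∀ X : Finset V, 1 ≤ X.card → X.card < ⌈(W.card : ℝ) / (2 * d)⌉₊ →
    d * (X.card : ℝ) ≤ ((G.extNeighborFinset X ∩ W).card : ℝ)
  joined : ∀ X Y : Finset V, Disjoint X Y →
    X.card = ⌈(W.card : ℝ) / (2 * d)⌉₊ → Y.card = ⌈(W.card : ℝ) / (2 * d)⌉₊ →
    0 < (G.interedges X Y).card

end SimpleGraph

set_option linter.unusedSectionVars false

/-! Only two consequences of expansion are needed. With m = ⌈|W|/(2d)⌉, any two disjoint m-sets are
joined by an edge, and every vertex has at least d neighbours in W. Put H = ℓ - 2 and let k = n/ℓ be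
the number of pairs. The choice d = 10ℓ√n gives 100Hm² ≤ k and d ≥ 40mH, and `Joined.routes` works
from these bounds.

Joinedness links pairs greedily with any prescribed length until O(m) pairs are left. If vertices
may be wasted, the last pairs are linked inside a small reserve E of large degree
(`Joined.exists_links`). A spanning cover instead needs a prepared structure that absorbs whatever
is left over.

Absorption comes from flexible classes (`Joined.exists_flex`). For vertices v_0, …, v_t, each
consecutive pair v_j, v_{j+1} carries a gadget (`exists_gadget`): a path for one of the given pairs
that can contain either of the two, its other vertices forming the same set. So t of the given pairs
cover the gadgets and the whole class except one vertex, chosen at will.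

A `Linker` connects any N pairs presented later, with exact length, and is always used up
completely. `Joined.exists_linker_core` builds one from stars whose leaves form flexible classes,
with Hall's theorem assigning pairs to stars; it spends about 2Nm given pairs, too many for large N.
`Joined.exists_linker_compose` is cheaper. Arrange classes in L levels and link greedily, one class
per level, until Lβ pairs remain. Then exactly Lβ classes are unused; a vertex from each becomes an
intermediate vertex for a remaining pair, reached by two smaller linkers. The greedy step needs only
(K+1)m vertices per level, where m ≤ K⁴, because `Joined.exists_reach` gains a factor K at each of
four levels.

Composition is used twice: with classes of K+1 vertices (`Joined.exists_linker`), then with single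
vertices (`Joined.routes_of_linkers`), where the levels are all that remains of W. There nothing
needs absorbing, and the cover is complete. -/

namespace PathCover

open Finset

variable {V : Type*} [DecidableEq V]

/-! ### Joined graphs, neighbourhoods and links -/

/-- Any two disjoint sets of at least `m` vertices are joined by an edge. -/
def Joined (G : SimpleGraph V) (m : ℕ) : Prop :=
  ∀ X Y : Finset V, Disjoint X Y → m ≤ #X → m ≤ #Y → ∃ x ∈ X, ∃ y ∈ Y, G.Adj x y

/-- The vertices of `U` having a neighbour in `S`. -/
noncomputable def nbrIn (G : SimpleGraph V) (U S : Finset V) : Finset V :=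
  open Classical in {v ∈ U | ∃ s ∈ S, G.Adj s v}

/-- `p` is the list of interior vertices of a walk with `L` interior vertices from `a` to `b`. -/
def IsLink (G : SimpleGraph V) (a b : V) (L : ℕ) (p : List V) : Prop :=
  p.length = L ∧ (a :: (p ++ [b])).IsChain G.Adj

variable {G : SimpleGraph V}

theorem mem_nbrIn {U S : Finset V} {v : V} :
    v ∈ nbrIn G U S ↔ v ∈ U ∧ ∃ s ∈ S, G.Adj s v := by
  classical
  simp [nbrIn]

theorem nbrIn_subset (U S : Finset V) : nbrIn G U S ⊆ U := fun _ h => (mem_nbrIn.1 h).1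

theorem nbrIn_mono {U U' S S' : Finset V} (hU : U ⊆ U') (hS : S ⊆ S') :
    nbrIn G U S ⊆ nbrIn G U' S' := fun v h => by
  obtain ⟨h1, s, hs, h2⟩ := mem_nbrIn.1 h
  exact mem_nbrIn.2 ⟨hU h1, s, hS hs, h2⟩

theorem nbrIn_biUnion {ι : Type*} (U : Finset V) (A : Finset ι) (f : ι → Finset V) :
    nbrIn G U (A.biUnion f) = A.biUnion fun a => nbrIn G U (f a) := by
  ext v
  simp only [mem_nbrIn, mem_biUnion]
  constructor
  · rintro ⟨h, s, ⟨a, ha, hs⟩, h2⟩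
    exact ⟨a, ha, h, s, hs, h2⟩
  · rintro ⟨a, ha, h, s, hs, h2⟩
    exact ⟨h, s, ⟨a, ha, hs⟩, h2⟩

/-- The vertices of `U` missed by `S` send no edge to `S`, so there are fewer than `m` of them. -/
theorem Joined.card_lt {m : ℕ} (hJ : Joined G m) {S U : Finset V} (hd : Disjoint S U)
    (hS : m ≤ #S) : #U < #(nbrIn G U S) + m := by
  by_contra! h
  have h1 : m ≤ #(U \ nbrIn G U S) := by
    rw [card_sdiff_of_subset (nbrIn_subset _ _)]; omega
  obtain ⟨x, hx, y, hy, hxy⟩ := hJ S (U \ nbrIn G U S) (hd.mono_right sdiff_subset) hS h1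
  rw [mem_sdiff] at hy
  exact hy.2 (mem_nbrIn.2 ⟨hy.1, x, hx, hxy⟩)

namespace IsLink

theorem nil {a b : V} (h : G.Adj a b) : IsLink G a b 0 [] := ⟨rfl, by simp [h]⟩

theorem append {a w b : V} {L₁ L₂ : ℕ} {p q : List V} (hp : IsLink G a w L₁ p)
    (hq : IsLink G w b L₂ q) : IsLink G a b (L₁ + 1 + L₂) (p ++ w :: q) := by
  refine ⟨by simp [hp.1, hq.1]; omega, ?_⟩
  have : a :: ((p ++ w :: q) ++ [b]) = (a :: p) ++ w :: (q ++ [b]) := by simp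
  rw [this, List.isChain_split]
  exact ⟨by simpa using hp.2, hq.2⟩

theorem reverse {a b : V} {L : ℕ} {p : List V} (hp : IsLink G a b L p) :
    IsLink G b a L p.reverse := by
  refine ⟨by simp [hp.1], ?_⟩
  have h := hp.2
  have e : b :: (p.reverse ++ [a]) = (a :: (p ++ [b])).reverse := by simp
  rw [e, List.isChain_reverse]
  exact h.imp fun _ _ h => h.symm

theorem cons {a u b : V} {L : ℕ} {p : List V} (h : G.Adj a u) (hp : IsLink G u b L p) :
    IsLink G a b (L + 1) (u :: p) := by
  simpa [Nat.add_comm] using (IsLink.nil h).append hp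

theorem concat {a u b : V} {L : ℕ} {p : List V} (hp : IsLink G a u L p) (h : G.Adj u b) :
    IsLink G a b (L + 1) (p ++ [u]) := by
  simpa using hp.append (IsLink.nil h)

end IsLink

/-! ### Reachability through levels -/

/-- The vertices in level `i` reachable from `S` by walks through consecutive levels. -/
noncomputable def reach (G : SimpleGraph V) (U : ℕ → Finset V) (S : Finset V) : ℕ → Finset V
  | 0 => S
  | i + 1 => nbrIn G (U i) (reach G U S i)

/-- This allows the set of starts to be thinned out by pigeonhole after the levels have been
traversed. -/
theorem reach_biUnion (U : ℕ → Finset V) (A : Finset V) (i : ℕ) :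
    reach G U A i = A.biUnion fun a => reach G U {a} i := by
  induction i with
  | zero => simp [reach]
  | succ i ih => simp only [reach]; rw [ih, nbrIn_biUnion]

/-- Step `i + 1` of `reach` lies in level `i`; the list records the `i` vertices before `v`, and `v`
itself is left out. -/
theorem exists_list_of_mem_reach {U : ℕ → Finset V} {a : V} {i : ℕ} {v : V}
    (h : v ∈ reach G U {a} (i + 1)) :
    ∃ p : List V, IsLink G a v i p ∧ ∀ l (hl : l < p.length), p[l] ∈ U l := by
  induction i generalizing v with
  | zero =>
    simp only [reach, mem_nbrIn, mem_singleton, exists_eq_left] at h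
    exact ⟨[], IsLink.nil h.2, by simp⟩
  | succ i ih =>
    rw [reach, mem_nbrIn] at h
    obtain ⟨-, s, hs, hsv⟩ := h
    obtain ⟨p, hp, hU⟩ := ih hs
    refine ⟨p ++ [s], hp.concat hsv, fun l hl => ?_⟩
    by_cases hlp : l < p.length
    · rw [List.getElem_append_left hlp]; exact hU l hlp
    · have : l = p.length := by simp at hl; omega
      subst this
      simp only [List.getElem_concat_length]
      rw [reach, mem_nbrIn] at hs
      rw [hp.1]; exact hs.1

theorem reach_subset {U : ℕ → Finset V} {S : Finset V} (i : ℕ) : reach G U S (i + 1) ⊆ U i :=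
  nbrIn_subset _ _

/-- If a union over at most `K * s` sets has at least `K * m` elements, then the union over some
`s` of them has at least `m` elements. -/
theorem exists_small_subset_biUnion {α β : Type*} [DecidableEq α] [DecidableEq β] (f : α → Finset β)
    {s m : ℕ} (K : ℕ) (A : Finset α) (hK : 0 < K) (hA : #A ≤ K * s)
    (hU : K * m ≤ #(A.biUnion f)) :
    ∃ B ⊆ A, #B ≤ s ∧ m ≤ #(B.biUnion f) := by
  induction K, hK using Nat.le_induction generalizing A with
  | base => exact ⟨A, Subset.rfl, by simpa using hA, by simpa using hU⟩
  | succ K hK ih =>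
    by_cases hs : #A ≤ s
    · exact ⟨A, Subset.rfl, hs, le_trans (Nat.le_mul_of_pos_left _ (by omega)) hU⟩
    obtain ⟨T, hTA, hT⟩ := exists_subset_card_eq (not_le.1 hs).le
    by_cases hm : m ≤ #(T.biUnion f)
    · exact ⟨T, hTA, hT.le, hm⟩
    have h1 : #(A \ T) ≤ K * s := by
      rw [card_sdiff_of_subset hTA, hT, Nat.sub_le_iff_le_add]; linarith
    have h2 : A.biUnion f = T.biUnion f ∪ (A \ T).biUnion f := by
      rw [← union_biUnion, union_sdiff_of_subset hTA]
    have h3 : K * m ≤ #((A \ T).biUnion f) := by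
      have := card_union_le (T.biUnion f) ((A \ T).biUnion f)
      rw [← h2] at this
      nlinarith
    obtain ⟨B, hB, h4⟩ := ih (A \ T) h1 h3
    exact ⟨B, hB.trans sdiff_subset, h4⟩

/-- Among `m` start vertices, one of them reaches `m` vertices of level `j`. -/
theorem Joined.exists_reach {m K : ℕ} (hm : 0 < m) (hK : 0 < K) (hJ : Joined G m)
    {U : ℕ → Finset V} {j : ℕ}
    (hU : ∀ l < j, (K + 1) * m ≤ #(U l)) (hdisj : ∀ l l', l < l' → l' < j → Disjoint (U l) (U l'))
    {A : Finset V} (hA : #A = m) (hmK : m ≤ K ^ j) (hAU : ∀ l < j, Disjoint A (U l)) :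
    ∃ a ∈ A, m ≤ #(reach G U {a} j) := by
  -- Fewer than `m` vertices of a level are missed, so each level multiplies the reach by `K`; by
  -- pigeonhole one `K`-th of the starts still reaches `m` vertices.
  have key : ∀ i ≤ j, ∃ B ⊆ A, #B ≤ K ^ (j - i) ∧ m ≤ #(reach G U B i) := by
    intro i
    induction i with
    | zero => exact fun _ => ⟨A, Subset.rfl, by simpa [hA] using hmK, by simp [reach, hA]⟩
    | succ i ih =>
      intro hi
      obtain ⟨B, hBA, hB, hr⟩ := ih (by omega)
      have hd : Disjoint (reach G U B i) (U i) := by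
        cases i with
        | zero => exact (hAU 0 (by omega)).mono_left hBA
        | succ i => exact (hdisj i (i + 1) (by omega) (by omega)).mono_left (reach_subset i)
      have h1 := hJ.card_lt hd hr
      have h2 := hU i (by omega)
      have h3 : K * m ≤ #(reach G U B (i + 1)) := by
        change K * m ≤ #(nbrIn G (U i) (reach G U B i))
        have : (K + 1) * m = K * m + m := by ring
        omega
      rw [reach_biUnion] at h3
      have h4 : #B ≤ K * K ^ (j - (i + 1)) := by
        rw [← pow_succ']
        have : j - (i + 1) + 1 = j - i := by omega
        rwa [this]
      obtain ⟨B', hB', h5, h6⟩ := exists_small_subset_biUnion _ K B hK h4 h3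
      exact ⟨B', hB'.trans hBA, h5, by rwa [reach_biUnion]⟩
  obtain ⟨B, hBA, hB, hr⟩ := key j le_rfl
  simp only [tsub_self, pow_zero] at hB
  rcases Nat.lt_or_ge 0 #B with h | h
  · obtain ⟨a, rfl⟩ := card_eq_one.1 (show #B = 1 by omega)
    exact ⟨a, by simpa using hBA, hr⟩
  · have : B = ∅ := card_eq_zero.1 (by omega)
    subst this
    rw [reach_biUnion] at hr
    simp at hr
    omega

/-- Once `m` vertices of a level are reached, fewer than `m` of the at least `2 * m` in the next are
missed. Positivity of `j` places the reached set inside a level, hence away from the next one. -/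
theorem Joined.reach_large {m : ℕ} (hJ : Joined G m) {U : ℕ → Finset V} {L : ℕ}
    (hU : ∀ l < L, 2 * m ≤ #(U l)) (hdisj : ∀ l l', l < l' → l' < L → Disjoint (U l) (U l'))
    {S : Finset V} {j : ℕ} (hj : 0 < j) (h : m ≤ #(reach G U S j)) {s : ℕ} (hjs : j ≤ s)
    (hs : s ≤ L) : m ≤ #(reach G U S s) := by
  induction s, hjs using Nat.le_induction with
  | base => exact h
  | succ s hjs ih =>
    have h1 := ih (by omega)
    have hd : Disjoint (reach G U S s) (U s) := by
      obtain ⟨i, rfl⟩ := Nat.exists_eq_add_of_lt (show 0 < s by omega)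
      simp only [Nat.zero_add] at *
      exact (hdisj i (i + 1) (by omega) (by omega)).mono_left (reach_subset i)
    have := hJ.card_lt hd h1
    have := hU s (by omega)
    change m ≤ #(nbrIn G (U s) (reach G U S s))
    omega

/-- A start reaching many vertices and an end reached by many vertices can be linked. -/
theorem Joined.exists_link {m : ℕ} (hJ : Joined G m) {U : ℕ → Finset V} {L : ℕ}
    (hU : ∀ l < L, 2 * m ≤ #(U l)) (hdisj : ∀ l l', l < l' → l' < L → Disjoint (U l) (U l'))
    {a b : V} {j : ℕ} (hj : 0 < j) (hL : 2 * j ≤ L) (ha : m ≤ #(reach G U {a} j))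
    (hb : m ≤ #(reach G (fun l => U (L - 1 - l)) {b} j)) :
    ∃ p, IsLink G a b L p ∧ ∀ l (hl : l < p.length), p[l] ∈ U l := by
  obtain ⟨i, rfl⟩ : ∃ i, j = i + 1 := ⟨j - 1, by omega⟩
  -- The front of `a` is carried to level `L - j - 1`, next to the front of `b` in level `L - j`;
  -- one edge between the fronts closes the path.
  have h1 := hJ.reach_large hU hdisj hj ha (s := L - (i + 1)) (by omega) (by omega)
  obtain ⟨s, hs⟩ : ∃ s, L - (i + 1) = s + 1 := ⟨L - (i + 1) - 1, by omega⟩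
  rw [hs] at h1
  have hd : Disjoint (reach G U {a} (s + 1)) (reach G (fun l => U (L - 1 - l)) {b} (i + 1)) :=
    (hdisj s (L - 1 - i) (by omega) (by omega)).mono (reach_subset s) (reach_subset i)
  obtain ⟨x, hx, y, hy, hxy⟩ := hJ _ _ hd h1 hb
  obtain ⟨p, hp, hpU⟩ := exists_list_of_mem_reach hx
  obtain ⟨q, hq, hqU⟩ := exists_list_of_mem_reach hy
  have hxU := reach_subset s hx
  have hyU : y ∈ U (L - 1 - i) := reach_subset i hy
  refine ⟨(p ++ [x]) ++ y :: q.reverse, ?_, fun l hl => ?_⟩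
  · have := (hp.concat hxy).append hq.reverse
    have e : s + 1 + 1 + i = L := by omega
    rwa [e] at this
  · have hpl := hp.1
    have hql := hq.1
    simp only [List.length_append, List.length_cons, List.length_reverse, List.length_nil] at hl
    rcases lt_trichotomy l s with h | h | h
    · rw [List.getElem_append_left (by simp; omega), List.getElem_append_left (by omega)]
      exact hpU l (by omega)
    · subst h
      rw [List.getElem_append_left (by simp; omega)]
      subst hpl
      simpa using hxU
    · rw [List.getElem_append_right (by simp; omega)]
      simp only [List.length_append, List.length_cons, List.length_nil, hpl]
      rcases Nat.lt_or_ge (s + 1) l with h' | h'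
      · obtain ⟨r, rfl⟩ : ∃ r, l = s + 1 + (r + 1) := ⟨l - (s + 2), by omega⟩
        have e : s + 1 + (r + 1) - (s + (0 + 1)) = r + 1 := by omega
        simp only [e, List.getElem_cons_succ, List.getElem_reverse]
        have := hqU (q.length - 1 - r) (by omega)
        have e2 : L - 1 - (q.length - 1 - r) = s + 1 + (r + 1) := by omega
        simp only [e2] at this
        exact this
      · have e : l = s + 1 := by omega
        subst e
        have e2 : L - 1 - i = s + 1 := by omega
        simpa [e2] using hyU

/-- Among `2 * m` pairs of vertices, one of them can be linked through the levels `U`. -/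
theorem Joined.exists_linked_pair {m K : ℕ} (hm : 0 < m) (hK : 0 < K) (hJ : Joined G m)
    {U : ℕ → Finset V} {L j : ℕ} (hj : 0 < j) (hL : 2 * j ≤ L) (hmK : m ≤ K ^ j)
    (hU : ∀ l < L, (K + 1) * m ≤ #(U l))
    (hdisj : ∀ l l', l < l' → l' < L → Disjoint (U l) (U l'))
    {ι : Type*} [DecidableEq ι] (P : Finset ι) (hP : 2 * m ≤ #P) (a b : ι → V)
    (ha : Set.InjOn a P) (hb : Set.InjOn b P) (haU : ∀ i ∈ P, ∀ l < L, a i ∉ U l)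
    (hbU : ∀ i ∈ P, ∀ l < L, b i ∉ U l) :
    ∃ i ∈ P, ∃ p, IsLink G (a i) (b i) L p ∧ ∀ l (hl : l < p.length), p[l] ∈ U l := by
  have hU2 : ∀ l < L, 2 * m ≤ #(U l) := fun l hl =>
    le_trans (Nat.mul_le_mul_right m (by omega)) (hU l hl)
  -- Stated for arbitrary levels so that it also applies to the reversed order: fewer than `m`
  -- starts fail and fewer than `m` ends fail.
  have main : ∀ (U' : ℕ → Finset V) (c : ι → V), Set.InjOn c P →
      (∀ l < j, (K + 1) * m ≤ #(U' l)) → (∀ l l', l < l' → l' < j → Disjoint (U' l) (U' l')) →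
      (∀ i ∈ P, ∀ l < j, c i ∉ U' l) → #{i ∈ P | ¬ m ≤ #(reach G U' {c i} j)} < m := by
    intro U' c hc h1 h2 h3
    by_contra! h
    obtain ⟨T, hTs, hT⟩ := exists_subset_card_eq h
    have hTP : T ⊆ P := hTs.trans (filter_subset _ _)
    obtain ⟨v, hv, hr⟩ := hJ.exists_reach hm hK h1 h2 (A := T.image c)
      (by rw [card_image_of_injOn (hc.mono (by exact_mod_cast hTP)), hT]) hmK (by
        intro l hl
        rw [disjoint_left]
        intro v hv
        obtain ⟨i, hi, rfl⟩ := mem_image.1 hv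
        exact h3 i (hTP hi) l hl)
    obtain ⟨i, hi, rfl⟩ := mem_image.1 hv
    exact absurd hr (not_le.2 (mem_filter.1 (hTs hi)).2)
  have h1 := main U a ha (fun l hl => hU l (by omega)) (fun l l' h h' => hdisj l l' h (by omega))
    (fun i hi l hl => haU i hi l (by omega))
  have h2 := main (fun l => U (L - 1 - l)) b hb (fun l hl => hU _ (by omega))
    (fun l l' h h' => (hdisj (L - 1 - l') (L - 1 - l) (by omega) (by omega)).symm)
    (fun i hi l hl => hbU i hi _ (by omega))
  obtain ⟨i, hi⟩ : (P \ ({i ∈ P | ¬ m ≤ #(reach G U {a i} j)} ∪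
      {i ∈ P | ¬ m ≤ #(reach G (fun l => U (L - 1 - l)) {b i} j)})).Nonempty := by
    rw [← card_pos]
    have := le_card_sdiff ({i ∈ P | ¬ m ≤ #(reach G U {a i} j)} ∪
      {i ∈ P | ¬ m ≤ #(reach G (fun l => U (L - 1 - l)) {b i} j)}) P
    have := card_union_le {i ∈ P | ¬ m ≤ #(reach G U {a i} j)}
      {i ∈ P | ¬ m ≤ #(reach G (fun l => U (L - 1 - l)) {b i} j)}
    omega
  simp only [mem_sdiff, mem_union, mem_filter, not_or, not_and, not_not] at hi
  exact ⟨i, hi.1, hJ.exists_link hU2 hdisj hj hL (hi.2.1 hi.1) (hi.2.2 hi.1)⟩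

/-! ### Linking prescribed pairs when vertices may be wasted -/

theorem exists_disjoint_subsets {α : Type*} [DecidableEq α] (s h : ℕ) (U : Finset α)
    (hU : s * h ≤ #U) :
    ∃ f : ℕ → Finset α, (∀ l < h, f l ⊆ U ∧ #(f l) = s) ∧
      ∀ l l', l < l' → l' < h → Disjoint (f l) (f l') := by
  induction h generalizing U with
  | zero => exact ⟨fun _ => ∅, by simp, by simp⟩
  | succ h ih =>
    obtain ⟨T, hTU, hT⟩ := exists_subset_card_eq (show s ≤ #U by nlinarith)
    obtain ⟨f, hf, hd⟩ := ih (U \ T) (by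
      rw [card_sdiff_of_subset hTU, hT, Nat.mul_succ] at *; omega)
    refine ⟨fun l => if l = h then T else f l, fun l hl => ?_, fun l l' hll hl' => ?_⟩
    · by_cases e : l = h
      · simp [e, hTU, hT]
      · simp only [e, if_false]
        exact ⟨(hf l (by omega)).1.trans sdiff_subset, (hf l (by omega)).2⟩
    · have e : l ≠ h := by omega
      simp only [e, if_false]
      by_cases e' : l' = h
      · simp only [e', if_true]
        exact disjoint_of_subset_left (hf l (by omega)).1 sdiff_disjoint
      · simp only [e', if_false]
        exact hd l l' hll (by omega)

theorem nodup_of_levels {U : ℕ → Finset V} {L : ℕ}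
    (hdisj : ∀ l l', l < l' → l' < L → Disjoint (U l) (U l')) {p : List V} (hp : p.length = L)
    (h : ∀ l (hl : l < p.length), p[l] ∈ U l) : p.Nodup := by
  rw [List.Nodup, List.pairwise_iff_getElem]
  intro i j hi hj hij e
  exact disjoint_left.1 (hdisj i j hij (hp ▸ hj)) (h i hi) (e ▸ h j hj)

/-- Two vertices with many neighbours in a large set `U` are linked through `U` by a path with any
prescribed number of interior vertices. -/
theorem Joined.exists_link_in {m : ℕ} (hJ : Joined G m) {h : ℕ} (hh : 2 ≤ h) {U : Finset V}
    {a b : V} (ha : 2 * m ≤ #(nbrIn G U {a})) (hb : 2 * m ≤ #(nbrIn G U {b}))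
    (hU : 2 * m * h + 2 * m ≤ #U) :
    ∃ p, IsLink G a b h p ∧ p.Nodup ∧ p.toFinset ⊆ U := by
  obtain ⟨A, hA, hAc⟩ := exists_subset_card_eq (show m ≤ #(nbrIn G U {a}) by omega)
  obtain ⟨B, hB, hBc⟩ := exists_subset_card_eq (show m ≤ #(nbrIn G U {b} \ A) by
    have := le_card_sdiff A (nbrIn G U {b}); omega)
  have hAB : Disjoint A B := disjoint_of_subset_right hB disjoint_sdiff
  have hAU : A ⊆ U := hA.trans (nbrIn_subset _ _)
  have hBU : B ⊆ U := hB.trans (sdiff_subset.trans (nbrIn_subset _ _))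
  obtain ⟨f, hf, hfd⟩ := exists_disjoint_subsets (2 * m) h (U \ (A ∪ B)) (by
    have := le_card_sdiff (A ∪ B) U
    have := card_union_le A B
    omega)
  have hfA : ∀ l < h, Disjoint (f l) A := fun l hl =>
    disjoint_of_subset_left (hf l hl).1 (disjoint_of_subset_right subset_union_left sdiff_disjoint)
  have hfB : ∀ l < h, Disjoint (f l) B := fun l hl =>
    disjoint_of_subset_left (hf l hl).1 (disjoint_of_subset_right subset_union_right sdiff_disjoint)
  -- Placing neighbours of `a` in the first level and neighbours of `b` in the last makes both
  -- fronts large at once, so `j = 1` suffices.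
  set F : ℕ → Finset V := fun l =>
    f l ∪ ((if l = 0 then A else ∅) ∪ if l = h - 1 then B else ∅) with hF
  have hFU : ∀ l < h, F l ⊆ U := fun l hl => by
    have := (hf l hl).1.trans sdiff_subset
    simp only [hF]
    refine union_subset this (union_subset ?_ ?_) <;> split_ifs <;> simp [*]
  have hFd : ∀ l l', l < l' → l' < h → Disjoint (F l) (F l') := fun l l' h1 h2 => by
    have e1 : l' ≠ 0 := by omega
    have e2 : l ≠ h - 1 := by omega
    simp only [hF, e1, e2, if_false, empty_union, union_empty, disjoint_union_left,
      disjoint_union_right]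
    refine ⟨⟨hfd l l' h1 h2, ?_⟩, ?_, ?_⟩
    · split_ifs
      · exact (hfA l' h2).symm
      · simp
    · split_ifs
      · exact hfB l (by omega)
      · simp
    · split_ifs <;> simp [hAB]
  obtain ⟨p, hp, hpF⟩ := hJ.exists_link (U := F) (L := h) (j := 1) (a := a) (b := b)
    (fun l hl => (hf l hl).2.ge.trans (card_le_card subset_union_left)) hFd one_pos (by omega)
    (by
      rw [← hAc]
      refine card_le_card fun v hv => ?_
      obtain ⟨h1, h2⟩ := mem_nbrIn.1 (hA hv)
      exact mem_nbrIn.2 ⟨by simp [hF, hv], h2⟩)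
    (by
      rw [← hBc]
      refine card_le_card fun v hv => ?_
      obtain ⟨h1, h2⟩ := mem_nbrIn.1 (sdiff_subset (hB hv))
      exact mem_nbrIn.2 ⟨by simp [hF, hv], h2⟩)
  refine ⟨p, hp, nodup_of_levels hFd hp.1 hpF, fun v hv => ?_⟩
  obtain ⟨l, hl, rfl⟩ := List.getElem_of_mem (List.mem_toFinset.1 hv)
  exact hFU l (hp.1 ▸ hl) (hpF l hl)

/-- Fewer than `m` vertices have few neighbours in a large set. -/
theorem Joined.card_lowDeg_lt {m D : ℕ} (hJ : Joined G m) {U T : Finset V}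
    (hU : m * D + 2 * m ≤ #U) (hT : ∀ v ∈ T, #(nbrIn G U {v}) ≤ D) : #T < m := by
  by_contra! h
  obtain ⟨T', hT'T, hT'⟩ := exists_subset_card_eq h
  have h1 := hJ.card_lt (S := T') (U := U \ T') disjoint_sdiff hT'.ge
  have h2 := le_card_sdiff T' U
  have h3 : #(nbrIn G (U \ T') T') ≤ m * D := by
    refine (card_le_card (nbrIn_mono sdiff_subset Subset.rfl)).trans ?_
    have : nbrIn G U T' = T'.biUnion fun v => nbrIn G U {v} := by
      conv_lhs => rw [← biUnion_singleton_eq_self (s := T'), nbrIn_biUnion]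
    rw [this, ← hT']
    exact card_biUnion_le_card_mul _ _ _ fun v hv => hT v (hT'T hv)
  omega

/-- Equality of a multiset sum of lists with `Z.val` says at once that the lists have no
repetitions, are pairwise disjoint and fill `Z`. Disjointness of links is carried in this form. -/
theorem card_sum_links {ι : Type*} {D : Finset ι} {a b : ι → V} {h : ℕ} {p : ι → List V}
    (hp : ∀ i ∈ D, IsLink G (a i) (b i) h (p i)) {Z : Finset V}
    (hZ : ∑ i ∈ D, (p i : Multiset V) = Z.val) : #Z = #D * h := by
  have := congrArg Multiset.card hZ
  rw [Multiset.card_sum] at this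
  simp only [Multiset.coe_card] at this
  rw [card_def, ← this, sum_congr rfl fun i hi => (hp i hi).1, sum_const, smul_eq_mul]

theorem insert_link {ι : Type*} [DecidableEq ι] {D : Finset ι} {a b : ι → V} {h : ℕ}
    {p : ι → List V} (hp : ∀ i ∈ D, IsLink G (a i) (b i) h (p i)) {Z : Finset V}
    (hZ : ∑ i ∈ D, (p i : Multiset V) = Z.val) {i : ι} (hi : i ∉ D) {q : List V}
    (hq : IsLink G (a i) (b i) h q) (hqn : q.Nodup) (hqZ : Disjoint q.toFinset Z) :
    ∃ p' : ι → List V, (∀ j ∈ insert i D, IsLink G (a j) (b j) h (p' j)) ∧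
      ∑ j ∈ insert i D, (p' j : Multiset V) = (q.toFinset ∪ Z).val := by
  refine ⟨Function.update p i q, fun j hj => ?_, ?_⟩
  · rcases mem_insert.1 hj with rfl | hj
    · simpa using hq
    · rw [Function.update_of_ne (ne_of_mem_of_not_mem hj hi)]
      exact hp j hj
  · rw [sum_insert hi, ← disjUnion_eq_union _ _ hqZ, disjUnion_val, Function.update_self]
    congr 1
    · rw [List.toFinset_val, hqn.dedup]
    · rw [← hZ]
      refine sum_congr rfl fun j hj => ?_
      rw [Function.update_of_ne (ne_of_mem_of_not_mem hj hi)]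

/-- A family of pairs can be linked by disjoint paths in a large set `A`, using only few vertices of
a set `E` in which all vertices have large degree. -/
theorem Joined.exists_links {m : ℕ} (hJ : Joined G m) {ι : Type*} [Fintype ι]
    [DecidableEq ι] {A E : Finset V} {h : ℕ} (hh : 2 ≤ h) (a b : ι → V)
    (ha : ∀ v, #{i | a i = v} ≤ 2) (hb : ∀ v, #{i | b i = v} ≤ 2)
    (hdeg : ∀ v, 4 * m * h + 2 * m ≤ #(nbrIn G (A ∩ E) {v}))
    (hsize : Fintype.card ι * h + (2 * m * m + 2 * m * h + 2 * m) ≤ #(A \ E)) :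
    ∃ Z ⊆ A, #(Z ∩ E) ≤ 4 * m * h ∧ #Z = Fintype.card ι * h ∧ ∃ p : ι → List V,
      (∀ i, IsLink G (a i) (b i) h (p i)) ∧ ∑ i, (p i : Multiset V) = Z.val := by
  have hfib : ∀ (c : ι → V), (∀ v, #{i | c i = v} ≤ 2) → ∀ (R : Finset ι) (T : Finset V),
      (∀ i ∈ R, c i ∈ T) → #R ≤ 2 * #T := fun c hc R T hT =>
    (card_le_mul_card_image_of_maps_to hT 2 fun v _ =>
      (card_le_card (filter_subset_filter _ (subset_univ _))).trans (hc v))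
  -- Outside `E`, fewer than `m` vertices have low degree and each starts (or ends) at most two
  -- pairs. Hence at most `4 * m` pairs are blocked, and any further pair can be linked.
  have phase1 : ∀ n ≤ Fintype.card ι - 4 * m, ∃ D : Finset ι, #D = n ∧ ∃ Z ⊆ A \ E,
      ∃ p : ι → List V, (∀ i ∈ D, IsLink G (a i) (b i) h (p i)) ∧
        ∑ i ∈ D, (p i : Multiset V) = Z.val := by
    intro n
    induction n with
    | zero => exact fun _ => ⟨∅, rfl, ∅, by simp, fun _ => [], by simp, by simp⟩
    | succ n ih =>
      intro hn
      obtain ⟨D, hD, Z, hZ, p, hp, hsum⟩ := ih (by omega)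
      have hZc := card_sum_links hp hsum
      have hU : 2 * m * m + 2 * m * h + 2 * m ≤ #((A \ E) \ Z) := by
        rw [card_sdiff_of_subset hZ, hZc, hD]
        have : n * h ≤ Fintype.card ι * h := Nat.mul_le_mul_right h (by omega)
        omega
      have hlow : ∀ (c : ι → V), (∀ v, #{i | c i = v} ≤ 2) →
          #{i ∈ Dᶜ | #(nbrIn G ((A \ E) \ Z) {c i}) ≤ 2 * m} ≤ 2 * m := by
        intro c hc
        have h1 := hJ.card_lowDeg_lt (D := 2 * m) (U := (A \ E) \ Z)
          (T := ({i ∈ Dᶜ | #(nbrIn G ((A \ E) \ Z) {c i}) ≤ 2 * m} : Finset ι).image c)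
          (by
            have : m * (2 * m) = 2 * m * m := by ring
            omega) (by
            simp only [mem_image, mem_filter]
            rintro _ ⟨i, ⟨-, hi⟩, rfl⟩
            exact hi)
        refine (hfib c hc _ _ fun i hi => mem_image_of_mem c hi).trans (by omega)
      obtain ⟨i, hi⟩ : (Dᶜ \ ({i ∈ Dᶜ | #(nbrIn G ((A \ E) \ Z) {a i}) ≤ 2 * m} ∪
          {i ∈ Dᶜ | #(nbrIn G ((A \ E) \ Z) {b i}) ≤ 2 * m})).Nonempty := by
        rw [← card_pos]
        have h1 := le_card_sdiff ({i ∈ Dᶜ | #(nbrIn G ((A \ E) \ Z) {a i}) ≤ 2 * m} ∪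
          {i ∈ Dᶜ | #(nbrIn G ((A \ E) \ Z) {b i}) ≤ 2 * m}) Dᶜ
        have h2 := card_union_le {i ∈ Dᶜ | #(nbrIn G ((A \ E) \ Z) {a i}) ≤ 2 * m}
          {i ∈ Dᶜ | #(nbrIn G ((A \ E) \ Z) {b i}) ≤ 2 * m}
        have h3 := hlow a ha
        have h4 := hlow b hb
        rw [card_compl] at h1
        omega
      simp only [mem_sdiff, mem_union, mem_filter, not_or, not_and, not_le, mem_compl] at hi
      obtain ⟨q, hq, hqn, hqU⟩ := hJ.exists_link_in hh (hi.2.1 hi.1).le (hi.2.2 hi.1).le (by omega)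
      obtain ⟨p', hp', hsum'⟩ := insert_link hp hsum hi.1 hq hqn
        (disjoint_of_subset_left hqU sdiff_disjoint)
      exact ⟨insert i D, by rw [card_insert_of_notMem hi.1, hD], _,
        union_subset (hqU.trans sdiff_subset) hZ, p', hp', hsum'⟩
  -- The last pairs, at most `4 * m`, may have any endpoints. All links of this phase use at most `4
  -- * m * h` vertices of `E`, so the degrees into `E` survive.
  have phase2 : ∀ n ≤ Fintype.card ι - (Fintype.card ι - 4 * m), ∃ D : Finset ι,
      #D = Fintype.card ι - 4 * m + n ∧ ∃ Z ⊆ A, #(Z ∩ E) ≤ n * h ∧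
      ∃ p : ι → List V, (∀ i ∈ D, IsLink G (a i) (b i) h (p i)) ∧
        ∑ i ∈ D, (p i : Multiset V) = Z.val := by
    intro n
    induction n with
    | zero =>
      intro _
      obtain ⟨D, hD, Z, hZ, p, hp⟩ := phase1 _ le_rfl
      refine ⟨D, hD, Z, hZ.trans sdiff_subset, ?_, p, hp⟩
      rw [disjoint_iff_inter_eq_empty.1 (disjoint_of_subset_left hZ sdiff_disjoint)]
      simp
    | succ n ih =>
      intro hn
      obtain ⟨D, hD, Z, hZ, hZE, p, hp, hsum⟩ := ih (by omega)
      have hZc := card_sum_links hp hsum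
      obtain ⟨i, hi⟩ : (Dᶜ).Nonempty := by
        rw [← card_pos, card_compl]; omega
      rw [mem_compl] at hi
      have hdeg' : ∀ v, 2 * m ≤ #(nbrIn G (A \ Z) {v}) := by
        intro v
        have h1 := le_card_sdiff (Z ∩ E) (nbrIn G (A ∩ E) {v})
        have h2 : nbrIn G (A ∩ E) {v} \ (Z ∩ E) ⊆ nbrIn G (A \ Z) {v} := by
          intro w hw
          simp only [mem_sdiff, mem_nbrIn, mem_inter] at hw ⊢
          tauto
        have h3 := card_le_card h2
        have h4 := hdeg v
        have h5 : n * h ≤ 4 * m * h := Nat.mul_le_mul_right h (by omega)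
        omega
      obtain ⟨q, hq, hqn, hqU⟩ := hJ.exists_link_in hh (hdeg' (a i)) (hdeg' (b i)) (by
        rw [card_sdiff_of_subset hZ, hZc]
        have h1 : #D * h ≤ Fintype.card ι * h := Nat.mul_le_mul_right h (card_le_univ D)
        have h2 := card_le_card (sdiff_subset (s := A) (t := E))
        omega)
      obtain ⟨p', hp', hsum'⟩ := insert_link hp hsum hi hq hqn
        (disjoint_of_subset_left hqU sdiff_disjoint)
      refine ⟨insert i D, by rw [card_insert_of_notMem hi, hD]; rfl, _,
        union_subset (hqU.trans sdiff_subset) hZ, ?_, p', hp', hsum'⟩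
      rw [union_inter_distrib_right]
      refine (card_union_le _ _).trans ?_
      have h1 : #(q.toFinset ∩ E) ≤ h := by
        rw [← hq.1]
        exact (card_le_card inter_subset_left).trans (List.toFinset_card_le _)
      rw [Nat.add_mul]
      omega
  obtain ⟨D, hD, Z, hZ, hZE, p, hp, hsum⟩ := phase2 _ le_rfl
  have hDu : D = univ := by
    rw [← card_eq_iff_eq_univ]; omega
  subst hDu
  refine ⟨Z, hZ, hZE.trans (Nat.mul_le_mul_right h (by omega)), ?_, p, fun i => hp i (mem_univ i),
    hsum⟩
  rw [card_sum_links hp hsum, card_univ]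

/-! ### Bookkeeping for the reserve and for routes -/

/-- All vertices have at least `D` neighbours in the part of `A` inside `E`, and at least `X` vertices
of `A` lie outside `E`. -/
structure Avail (G : SimpleGraph V) (A E : Finset V) (D X : ℕ) : Prop where
  deg : ∀ v, D ≤ #(nbrIn G (A ∩ E) {v})
  size : X ≤ #(A \ E)

/-- Only the part of `S` inside the reserve costs degree, while all of `S` is charged against the
size. Structures avoiding `E` are therefore free in degree. -/
theorem Avail.sdiff {A E S : Finset V} {D X D' X' s y : ℕ} (hA : Avail G A E D X)
    (hs : #(S ∩ E) ≤ s) (hy : #S ≤ y) (hD : D' + s ≤ D) (hX : X' + y ≤ X) :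
    Avail G (A \ S) E D' X' where
  deg v := by
    have h1 := le_card_sdiff (S ∩ E) (nbrIn G (A ∩ E) {v})
    have h2 : nbrIn G (A ∩ E) {v} \ (S ∩ E) ⊆ nbrIn G ((A \ S) ∩ E) {v} := by
      intro w hw
      simp only [mem_sdiff, mem_nbrIn, mem_inter] at hw ⊢
      tauto
    have h3 := card_le_card h2
    have h4 := hA.deg v
    omega
  size := by
    have h1 := le_card_sdiff S (A \ E)
    have h2 : (A \ S) \ E = (A \ E) \ S := by
      ext; simp only [mem_sdiff]; tauto
    have h4 := hA.size
    rw [h2]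
    omega

/-- The pairs `(x i, y i)`, `i ∈ I`, can be linked with `H` interior vertices each, the interiors
forming the multiset `S`. -/
def Routes {κ : Type*} (G : SimpleGraph V) (x y : κ → V) (H : ℕ) (I : Finset κ)
    (S : Multiset V) : Prop :=
  ∃ r : κ → List V, (∀ i ∈ I, IsLink G (x i) (y i) H (r i)) ∧ ∑ i ∈ I, (r i : Multiset V) = S

section Routes

variable {κ : Type*} [DecidableEq κ] {x y : κ → V} {H : ℕ}

theorem Routes.union {I₁ I₂ : Finset κ} {S₁ S₂ : Multiset V} (h₁ : Routes G x y H I₁ S₁)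
    (h₂ : Routes G x y H I₂ S₂) (hd : Disjoint I₁ I₂) : Routes G x y H (I₁ ∪ I₂) (S₁ + S₂) := by
  obtain ⟨r₁, h₁, s₁⟩ := h₁
  obtain ⟨r₂, h₂, s₂⟩ := h₂
  have hd' : ∀ i ∈ I₂, i ∉ I₁ := fun i h h' => disjoint_left.1 hd h' h
  refine ⟨fun i => if i ∈ I₁ then r₁ i else r₂ i, fun i hi => ?_, ?_⟩
  · by_cases h : i ∈ I₁
    · simpa [h] using h₁ i h
    · simpa [h] using h₂ i ((mem_union.1 hi).resolve_left h)
  · rw [sum_union hd, ← s₁, ← s₂]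
    congr 1
    · exact sum_congr rfl fun i hi => by simp [hi]
    · exact sum_congr rfl fun i hi => by simp [hd' i hi]

theorem Routes.empty : Routes G x y H ∅ 0 := ⟨fun _ => [], by simp, by simp⟩

theorem Routes.of_embedding {ι : Type*} [Fintype ι] (e : ι ↪ κ) {p : ι → List V}
    (hp : ∀ i, IsLink G (x (e i)) (y (e i)) H (p i)) :
    Routes G x y H (univ.map e) (∑ i, (p i : Multiset V)) := by
  refine ⟨Function.extend e p fun _ => [], fun i hi => ?_, ?_⟩
  · obtain ⟨j, -, rfl⟩ := mem_map.1 hi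
    rw [e.injective.extend_apply]
    exact hp j
  · rw [sum_map]
    exact sum_congr rfl fun i _ => by rw [e.injective.extend_apply]

theorem Routes.card {I : Finset κ} {S : Multiset V} (h : Routes G x y H I S) :
    Multiset.card S = #I * H := by
  obtain ⟨r, h, rfl⟩ := h
  rw [Multiset.card_sum]
  simp only [Multiset.coe_card]
  rw [sum_congr rfl fun i hi => (h i hi).1, sum_const, smul_eq_mul]

end Routes

theorem nodup_of_sum_eq {ι : Type*} [Fintype ι] {p : ι → List V} {Z : Finset V}
    (h : ∑ i, (p i : Multiset V) = Z.val) (i : ι) : (p i).Nodup := by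
  have h1 : (p i : Multiset V) ≤ Z.val := by
    rw [← h]; exact single_le_sum (fun _ _ => Multiset.zero_le _) (mem_univ i)
  exact Multiset.coe_nodup.1 (Multiset.nodup_of_le h1 Z.nodup)

theorem eq_of_sum_eq {ι : Type*} [Fintype ι] [DecidableEq ι] {p : ι → List V} {Z : Finset V}
    (h : ∑ i, (p i : Multiset V) = Z.val) {i j : ι} {v : V} (hi : v ∈ p i) (hj : v ∈ p j) :
    i = j := by
  by_contra hij
  have h1 : (p i : Multiset V) + p j ≤ Z.val := by
    rw [← h, ← sum_pair (f := fun i => (p i : Multiset V)) hij]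
    exact sum_le_sum_of_subset (subset_univ _)
  have h2 := Multiset.nodup_of_le h1 Z.nodup
  rw [Multiset.nodup_add] at h2
  exact Multiset.disjoint_left.1 h2.2.2 hi hj

theorem mem_of_sum_eq {ι : Type*} [Fintype ι] {p : ι → List V} {Z : Finset V}
    (h : ∑ i, (p i : Multiset V) = Z.val) {i : ι} {v : V} (hi : v ∈ p i) : v ∈ Z := by
  rw [← mem_val, ← h, Multiset.mem_sum]
  exact ⟨i, mem_univ i, hi⟩

theorem card_fiber_le_two {α β : Type*} [Fintype α] [DecidableEq β] {c : α → β}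
    (hc : Function.Injective c) (v : β) : #{i | c i = v} ≤ 2 := by
  refine (card_le_one.2 fun i hi j hj => hc ?_).trans one_le_two
  rw [(mem_filter.1 hi).2, (mem_filter.1 hj).2]

/-- Each gadget needs two parallel paths between the same two class vertices, one per Boolean; hence
multiplicity two is allowed in `Joined.exists_links`. -/
theorem card_fiber_prod_bool_le_two {α β : Type*} [Fintype α] [DecidableEq α] [DecidableEq β]
    {c : α → β} (hc : Function.Injective c) (v : β) :
    #{i : α × Bool | c i.1 = v} ≤ 2 := by
  have : Set.InjOn Prod.snd (({i : α × Bool | c i.1 = v} : Finset (α × Bool)) : Set (α × Bool)) := by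
    intro i hi j hj h
    simp only [coe_filter, mem_univ, true_and, Set.mem_ofPred_eq] at hi hj
    exact Prod.ext (hc (hi.trans hj.symm)) h
  rw [← card_image_of_injOn this]
  exact (card_le_univ _).trans (by simp)

/-! ### Gadgets and flexible classes -/

/-- A gadget: from the two paths `v a c d v'` and `v b f g v'` and connecting paths one obtains
two paths from `x` to `y`, with the same vertices except that one uses `v` and the other `v'`. -/
theorem exists_gadget {x y v v' a b c d f g : V} {la bc df gy : List V} {h : ℕ}
    (h₁ : IsLink G v v' 3 [a, c, d]) (h₂ : IsLink G v v' 3 [b, f, g])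
    (hla : IsLink G x a 3 la) (hbc : IsLink G b c 3 bc) (hdf : IsLink G d f 3 df)
    (hgy : IsLink G g y h gy) {u : V} (hu : u = v ∨ u = v') :
    ∃ p, IsLink G x y (16 + h) p ∧ (p : Multiset V) = (([a, c, d] : List V) : Multiset V) +
      (([b, f, g] : List V) : Multiset V) + (la : Multiset V) + (bc : Multiset V) +
      (df : Multiset V) + (gy : Multiset V) + {u} := by
  have e₁ := h₁.2
  have e₂ := h₂.2
  simp only [List.cons_append, List.nil_append, List.isChain_cons_cons, List.isChain_singleton,
    and_true] at e₁ e₂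
  obtain ⟨va, ac, cd, dv⟩ := e₁
  obtain ⟨vb, bf, fg, gv⟩ := e₂
  rcases hu with rfl | rfl
  -- The route with `v` is x, `la`, a, v, b, `bc`, c, d, `df`, f, g, `gy`, y.
  · have key := hla.append (((IsLink.nil vb).cons va.symm).append (hbc.append
      ((IsLink.nil cd).append (hdf.append ((IsLink.nil fg).append hgy)))))
    refine ⟨_, key.imp_left fun h => ?_, ?_⟩
    · rw [h]; omega
    · simp only [← Multiset.coe_add, ← Multiset.cons_coe, ← Multiset.singleton_add,
        Multiset.coe_nil]
      abel
  -- The route with `v'` is x, `la`, a, c, `bc` reversed, b, f, `df` reversed, d, v', g, `gy`, y.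
  · have key := hla.append ((IsLink.nil ac).append (hbc.reverse.append ((IsLink.nil bf).append
      (hdf.reverse.append (((IsLink.nil gv.symm).cons dv).append hgy)))))
    refine ⟨_, key.imp_left fun h => ?_, ?_⟩
    · rw [h]; omega
    · simp only [← Multiset.coe_add, ← Multiset.cons_coe, ← Multiset.singleton_add,
        Multiset.coe_nil, Multiset.coe_reverse]
      abel

/-- Flexible classes: for vertices `v c 0, …, v c t` in each class `c`, some pairs `(x i, y i)` can be
linked by paths covering a fixed set `S` and all but any one vertex of each class. -/
theorem Joined.exists_flex {m : ℕ} (hJ : Joined G m) {κ γ : Type*} [DecidableEq κ]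
    [Fintype γ] [DecidableEq γ] {t H : ℕ} (hH : 18 ≤ H) {x y : κ → V}
    (hx : Function.Injective x) (hy : Function.Injective y) (v : γ → Fin (t + 1) → V)
    (hv : Function.Injective fun q : γ × Fin (t + 1) => v q.1 q.2) {A E : Finset V}
    (hxA : ∀ i, x i ∉ A) (e : γ × Fin t ↪ κ)
    (hA : Avail G A E (4 * m * H + 2 * m)
      (Fintype.card γ * t * H + (2 * m * m + 2 * m * H + 2 * m))) :
    ∃ S ⊆ A, #(S ∩ E) ≤ 4 * m * H ∧ ∀ r : γ → Fin (t + 1), Routes G x y H (univ.map e)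
      (S.val + ∑ c, ∑ j : Fin t, {v c ((r c).succAbove j)}) := by
  have hcard : Fintype.card (γ × Fin t) = Fintype.card γ * t := by simp
  set N := Fintype.card γ * t with hN
  have hinj : ∀ w : Fin t → Fin (t + 1), Function.Injective w →
      Function.Injective fun g : γ × Fin t => v g.1 (w g.2) := by
    intro w hw g g' h
    have := hv (a₁ := (g.1, w g.2)) (a₂ := (g'.1, w g'.2)) h
    rw [Prod.mk.injEq] at this
    exact Prod.ext this.1 (hw this.2)
  -- A gadget has six vertices on its two paths, three connections of three vertices, and one of
  -- `v`, `v'`: sixteen. The last connection takes the remaining `h ≥ 2`.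
  obtain ⟨h, rfl⟩ : ∃ h, H = 16 + h := ⟨H - 16, by omega⟩
  -- the two paths between consecutive vertices of a class
  obtain ⟨Z₁, hZ₁, hZ₁E, hZ₁c, p, hp, hps⟩ := hJ.exists_links (ι := (γ × Fin t) × Bool)
    (A := A) (E := E) (h := 3) (by omega)
    (fun i => v i.1.1 i.1.2.castSucc) (fun i => v i.1.1 i.1.2.succ)
    (card_fiber_prod_bool_le_two (hinj _ (Fin.castSucc_injective t)))
    (card_fiber_prod_bool_le_two (hinj _ (Fin.succ_injective t)))
    (fun v => le_trans (by nlinarith) (hA.deg v))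
    (le_trans (by rw [Fintype.card_prod, hcard, Fintype.card_bool]; nlinarith) hA.size)
  have hp3 := fun i => List.length_eq_three.1 (hp i).1
  choose u₁ u₂ u₃ hu using hp3
  have hu1 : ∀ i, u₁ i ∈ p i := fun i => by simp [hu i]
  have hu2 : ∀ i, u₂ i ∈ p i := fun i => by simp [hu i]
  have hu3 : ∀ i, u₃ i ∈ p i := fun i => by simp [hu i]
  have hnd : ∀ i, u₁ i ≠ u₂ i ∧ u₁ i ≠ u₃ i ∧ u₂ i ≠ u₃ i := fun i => by
    have := nodup_of_sum_eq hps i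
    rw [hu i] at this
    simp at this
    tauto
  have hpe : ∀ {i j : (γ × Fin t) × Bool} {w w' : V}, w ∈ p i → w' ∈ p j → w = w' → i = j :=
    fun hi hj h => eq_of_sum_eq hps hi (h ▸ hj)
  have hZ₁x : ∀ i (k : κ) (w : V), w ∈ p i → w ≠ x k := fun i k w hw h => by
    have := hZ₁ (mem_of_sum_eq hps hw)
    rw [h] at this
    exact hxA k this
  have hA₁ : Avail G (A \ Z₁) E (4 * m * (4 + h) + 2 * m + 3 * (4 * m))
      (N * (10 + h) + (2 * m * m + 2 * m * (16 + h) + 2 * m)) := by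
    refine hA.sdiff hZ₁E hZ₁c.le (by nlinarith) ?_
    rw [Fintype.card_prod, hcard, Fintype.card_bool]; nlinarith
  -- connecting paths
  obtain ⟨Z₂, hZ₂, hZ₂E, hZ₂c, q, hq, hqs⟩ := hJ.exists_links
    (ι := (γ × Fin t) ⊕ ((γ × Fin t) ⊕ (γ × Fin t)))
    (A := A \ Z₁) (E := E) (h := 3) (by omega)
    (Sum.elim (fun g => u₁ (g, false)) (Sum.elim (fun g => u₃ (g, true)) (fun g => x (e g))))
    (Sum.elim (fun g => u₂ (g, true)) (Sum.elim (fun g => u₂ (g, false)) (fun g => u₁ (g, true))))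
    (card_fiber_le_two (by
      refine Function.Injective.sumElim (fun g g' h => ?_) (Function.Injective.sumElim
        (fun g g' h => ?_) (hx.comp e.injective) fun g g' h => ?_) fun g s h => ?_
      · exact congrArg Prod.fst (hpe (hu1 (g, false)) (hu1 (g', false)) h)
      · exact congrArg Prod.fst (hpe (hu3 (g, true)) (hu3 (g', true)) h)
      · exact hZ₁x _ _ _ (hu3 (g, true)) h
      · rcases s with g' | g'
        · exact absurd (congrArg Prod.snd (hpe (hu1 (g, false)) (hu3 (g', true)) h)) (by simp)
        · exact hZ₁x _ _ _ (hu1 (g, false)) h))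
    (card_fiber_le_two (by
      refine Function.Injective.sumElim (fun g g' h => ?_) (Function.Injective.sumElim
        (fun g g' h => ?_) (fun g g' h => ?_) fun g g' h => ?_) fun g s h => ?_
      · exact congrArg Prod.fst (hpe (hu2 (g, true)) (hu2 (g', true)) h)
      · exact congrArg Prod.fst (hpe (hu2 (g, false)) (hu2 (g', false)) h)
      · exact congrArg Prod.fst (hpe (hu1 (g, true)) (hu1 (g', true)) h)
      · exact absurd (congrArg Prod.snd (hpe (hu2 (g, false)) (hu1 (g', true)) h)) (by simp)
      · rcases s with g' | g'
        · exact absurd (congrArg Prod.snd (hpe (hu2 (g, true)) (hu2 (g', false)) h)) (by simp)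
        · have h' : u₂ (g, true) = u₁ (g', true) := h
          rw [← hpe (hu2 (g, true)) (hu1 (g', true)) h'] at h'
          exact (hnd _).1 h'.symm))
    (fun v => le_trans (by nlinarith) (hA₁.deg v))
    (le_trans (by simp only [Fintype.card_sum, hcard]; nlinarith) hA₁.size)
  have hA₂ : Avail G ((A \ Z₁) \ Z₂) E (4 * m * (4 + h) + 2 * m)
      (N * (1 + h) + (2 * m * m + 2 * m * (16 + h) + 2 * m)) := by
    refine hA₁.sdiff hZ₂E hZ₂c.le (by nlinarith) ?_
    simp only [Fintype.card_sum, hcard]; nlinarith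
  obtain ⟨Z₃, hZ₃, hZ₃E, hZ₃c, s, hs, hss⟩ := hJ.exists_links (ι := γ × Fin t)
    (A := (A \ Z₁) \ Z₂) (E := E) (h := h) (by omega)
    (fun g => u₃ (g, false)) (fun g => y (e g))
    (card_fiber_le_two fun g g' h => by
      exact congrArg Prod.fst (hpe (hu3 (g, false)) (hu3 (g', false)) h))
    (card_fiber_le_two (hy.comp e.injective))
    (fun v => le_trans (by nlinarith) (hA₂.deg v))
    (le_trans (by rw [hcard]; nlinarith) hA₂.size)
  have hd₁ : Disjoint Z₁ Z₂ := (disjoint_of_subset_left hZ₂ sdiff_disjoint).symm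
  have hd₂ : Disjoint (Z₁ ∪ Z₂) Z₃ := by
    rw [sdiff_sdiff_left] at hZ₃
    exact (disjoint_of_subset_left hZ₃ sdiff_disjoint).symm
  refine ⟨Z₁ ∪ Z₂ ∪ Z₃, ?_, ?_, fun r => ?_⟩
  · exact union_subset (union_subset hZ₁ (hZ₂.trans sdiff_subset))
      (hZ₃.trans (sdiff_subset.trans sdiff_subset))
  · rw [union_inter_distrib_right, union_inter_distrib_right]
    have h1 := card_union_le (Z₁ ∩ E ∪ Z₂ ∩ E) (Z₃ ∩ E)
    have h2 := card_union_le (Z₁ ∩ E) (Z₂ ∩ E)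
    nlinarith
  · have hg : ∀ g : γ × Fin t, ∃ l, IsLink G (x (e g)) (y (e g)) (16 + h) l ∧
        (l : Multiset V) = (p (g, true) : Multiset V) + (p (g, false) : Multiset V) +
          (q (Sum.inr (Sum.inr g)) : Multiset V) + (q (Sum.inl g) : Multiset V) +
          (q (Sum.inr (Sum.inl g)) : Multiset V) + (s g : Multiset V) +
          {v g.1 ((r g.1).succAbove g.2)} := by
      intro g
      have h₁ := hp (g, true)
      have h₂ := hp (g, false)
      rw [hu] at h₁ h₂
      rw [hu (g, true), hu (g, false)]
      refine exists_gadget h₁ h₂ (hq (Sum.inr (Sum.inr g))) (hq (Sum.inl g))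
        (hq (Sum.inr (Sum.inl g))) (hs g) ?_
      -- When vertex r of a class is omitted, gadgets below r take the lower of their two vertices
      -- and the others the upper, which is exactly `succAbove`.
      unfold Fin.succAbove
      split_ifs <;> simp
    choose l hl hls using hg
    have := Routes.of_embedding (x := x) (y := y) e hl
    convert this using 1
    rw [sum_congr rfl fun g _ => hls g]
    simp only [sum_add_distrib]
    rw [← disjUnion_eq_union _ _ hd₂, disjUnion_val, ← disjUnion_eq_union _ _ hd₁, disjUnion_val,
      ← hps, ← hqs, ← hss]
    simp only [Fintype.sum_prod_type, Fintype.sum_sum_type, Fintype.sum_bool, sum_add_distrib]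
    abel

/-! ### Linkers from stars and Hall's theorem -/

/-- `S` can link any `N` pairs of vertices outside `S ∪ B`, using `L` interior vertices for each of
them, while the remaining vertices of `S` are covered by paths linking the pairs `(x i, y i)`,
`i ∈ I`. -/
structure Linker {κ : Type*} (G : SimpleGraph V) (x y : κ → V) (H N L : ℕ) (S : Finset V)
    (I : Finset κ) (B : Finset V) : Prop where
  card : #S = N * L + #I * H
  link : ∀ a b : Fin N → V, Function.Injective a → Function.Injective b →
    (∀ j, a j ∉ S ∪ B) → (∀ j, b j ∉ S ∪ B) → ∃ p : Fin N → List V,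
      (∀ j, IsLink G (a j) (b j) L (p j)) ∧ ∃ T, Routes G x y H I T ∧
        ∑ j, (p j : Multiset V) + T = S.val

theorem map_univ_val {ι α : Type*} [Fintype ι] (f : ι ↪ α) :
    (univ.map f).val = ∑ i, ({f i} : Multiset α) := by
  rw [← sum_multiset_singleton, sum_map]

theorem union_val_of_disjoint {s t : Finset V} (h : Disjoint s t) :
    (s ∪ t).val = s.val + t.val := by
  rw [← disjUnion_eq_union _ _ h, disjUnion_val]

/-- Disjoint stars with `m` leaves each can be found in a large set. -/
theorem Joined.exists_stars {m : ℕ} (hJ : Joined G m) {A : Finset V} (N : ℕ)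
    (hA : N * (m + 1) + (m * m + 2 * m + 1) ≤ #A) :
    ∃ w : Fin N → Option (Fin m) → V,
      (Function.Injective fun i : Fin N × Option (Fin m) => w i.1 i.2) ∧ (∀ i o, w i o ∈ A) ∧
      ∀ i l, G.Adj (w i none) (w i (some l)) := by
  induction N with
  | zero => exact ⟨fun i => i.elim0, fun i => i.1.elim0, fun i => i.elim0, fun i => i.elim0⟩
  | succ N ih =>
    obtain ⟨w, hw, hwA, hwG⟩ := ih (by nlinarith)
    set U := A \ univ.map ⟨_, hw⟩ with hU
    have hUc : m * m + 2 * m + 1 ≤ #U := by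
      rw [hU]
      have := le_card_sdiff (univ.map ⟨_, hw⟩) A
      rw [card_map, card_univ] at this
      simp only [Fintype.card_prod, Fintype.card_fin, Fintype.card_option] at this
      have : (N + 1) * (m + 1) = N * (m + 1) + (m + 1) := by ring
      omega
    obtain ⟨c, hc, hcm⟩ : ∃ c ∈ U, m ≤ #(nbrIn G U {c}) := by
      by_contra! h
      have := hJ.card_lowDeg_lt (U := U) (T := U) (D := m) (by omega) fun v hv => (h v hv).le
      have := Nat.zero_le (m * m)
      omega
    obtain ⟨T, hT, hTc⟩ := exists_subset_card_eq hcm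
    have eT := (T.equivFinOfCardEq hTc).symm
    have hTU : ∀ l, (eT l : V) ∈ U ∧ G.Adj c (eT l) := fun l => by
      simpa [mem_nbrIn] using hT (eT l).2
    set w₀ : Option (Fin m) → V := fun o => o.elim c fun l => eT l with hw₀
    have hw₀U : ∀ o, w₀ o ∈ U := by
      rintro (_ | l)
      · exact hc
      · exact (hTU l).1
    have hw₀i : Function.Injective w₀ := by
      rintro (_ | l) (_ | l') h
      · rfl
      · exact absurd h (hTU l').2.ne
      · exact absurd h (hTU l).2.ne'
      · exact congrArg some (eT.injective (Subtype.ext h))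
    have hne : ∀ o i o', w₀ o ≠ w i o' := fun o i o' h => by
      have := hw₀U o
      rw [h, hU, mem_sdiff] at this
      exact this.2 (mem_map.2 ⟨(i, o'), mem_univ _, rfl⟩)
    refine ⟨Fin.cons w₀ w, ?_, ?_, ?_⟩
    · rintro ⟨i, o⟩ ⟨j, o'⟩ h
      induction i using Fin.cases with
      | zero =>
        induction j using Fin.cases with
        | zero => simpa using hw₀i h
        | succ j => exact absurd h (hne _ _ _)
      | succ i =>
        induction j using Fin.cases with
        | zero => exact absurd h.symm (hne _ _ _)
        | succ j =>
          have := hw (a₁ := (i, o)) (a₂ := (j, o')) h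
          simpa using this
    · intro i o
      induction i using Fin.cases with
      | zero => exact sdiff_subset (hw₀U o)
      | succ i => exact hwA i o
    · intro i l
      induction i using Fin.cases with
      | zero => exact (hTU l).2
      | succ i => exact hwG i l

/-- Linkers exist for families of `q ≥ 6 * m` pairs. -/
theorem Joined.exists_linker_core [Fintype V] {t q H L : ℕ} (hJ : Joined G (t + 1)) {κ : Type*}
    [DecidableEq κ] (hH : 18 ≤ H) (hL : 6 ≤ L) (hq : 6 * (t + 1) ≤ q) {x y : κ → V}
    (hx : Function.Injective x) (hy : Function.Injective y) {A E : Finset V}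
    (hxA : ∀ i, x i ∉ A) (e : (Fin q × Bool) × Fin t ↪ κ)
    (hA : Avail G A E (4 * (t + 1) * (H + L) + 2 * (t + 1))
      (2 * q * ((t + 1) * H + L + (t + 2)) +
        4 * ((t + 1) * (t + 1) + (t + 1) * (H + L) + (t + 1)))) :
    ∃ S ⊆ A, #(S ∩ E) ≤ 4 * (t + 1) * (H + L) ∧ ∃ B : Finset V, #B ≤ 6 * (t + 1) ∧
      Linker G x y H q L S (univ.map e) B := by
  classical
  -- A link runs leaf, centre, `h` vertices, centre, leaf.
  obtain ⟨h, rfl⟩ : ∃ h, L = h + 4 := ⟨L - 4, by omega⟩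
  have hcard : Fintype.card (Fin q × Bool) = q * 2 := by simp
  obtain ⟨w', hw', hwA', hwG'⟩ := hJ.exists_stars (A := A \ E) (Fintype.card (Fin q × Bool))
    (le_trans (by
      rw [hcard]
      nlinarith [Nat.zero_le (q * t * H), Nat.zero_le (q * H), Nat.zero_le (q * h), Nat.zero_le (t * t),
      Nat.zero_le (t * H), Nat.zero_le (t * h), Nat.zero_le (q * t)]) hA.size)
  set ε := Fintype.equivFin (Fin q × Bool) with hε
  set w : Fin q × Bool → Option (Fin (t + 1)) → V := fun c => w' (ε c) with hw_def
  have hw : Function.Injective fun i : (Fin q × Bool) × Option (Fin (t + 1)) => w i.1 i.2 := by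
    intro i j h
    have := hw' (a₁ := (ε i.1, i.2)) (a₂ := (ε j.1, j.2)) h
    rw [Prod.mk.injEq] at this
    exact Prod.ext (ε.injective this.1) this.2
  have hwG : ∀ c l, G.Adj (w c none) (w c (some l)) := fun c l => hwG' _ l
  set Z₀ := univ.map ⟨_, hw⟩ with hZ₀
  have hZ₀A : Z₀ ⊆ A \ E := by
    intro v hv
    obtain ⟨i, -, rfl⟩ := mem_map.1 hv
    exact hwA' _ _
  have hZ₀E : Z₀ ∩ E = ∅ :=
    disjoint_iff_inter_eq_empty.1 (disjoint_of_subset_left hZ₀A sdiff_disjoint)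
  have hZ₀c : #Z₀ = q * 2 * (t + 2) := by
    rw [card_map, card_univ, Fintype.card_prod, hcard]
    simp
  have hA₁ : Avail G (A \ Z₀) E (4 * (t + 1) * (H + (h + 4)) + 2 * (t + 1))
      (2 * q * ((t + 1) * H + (h + 4)) +
        4 * ((t + 1) * (t + 1) + (t + 1) * (H + (h + 4)) + (t + 1))) :=
    hA.sdiff (s := 0) (by simp [hZ₀E]) hZ₀c.le (by omega) (by nlinarith)
  have hw1 : ∀ β, Function.Injective fun c => w (c, β) none := fun β c c' hc => by
    have := hw (a₁ := ((c, β), none)) (a₂ := ((c', β), none)) hc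
    simpa using this
  obtain ⟨Z₁, hZ₁, hZ₁E, hZ₁c, z, hz, hzs⟩ := hJ.exists_links (ι := Fin q) (A := A \ Z₀) (E := E)
    (h := h) (by omega) (fun c => w (c, false) none) (fun c => w (c, true) none)
    (card_fiber_le_two (hw1 _)) (card_fiber_le_two (hw1 _))
    (fun v => le_trans (by nlinarith) (hA₁.deg v))
    (le_trans (by
      rw [Fintype.card_fin]
      nlinarith [Nat.zero_le (q * t * H), Nat.zero_le (q * H), Nat.zero_le (q * h), Nat.zero_le (t * t),
      Nat.zero_le (t * H), Nat.zero_le (t * h), Nat.zero_le (q * t)]) hA₁.size)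
  rw [Fintype.card_fin] at hZ₁c
  have hA₂ : Avail G ((A \ Z₀) \ Z₁) E (4 * (t + 1) * H + 2 * (t + 1))
      (2 * q * ((t + 1) * H) +
        4 * ((t + 1) * (t + 1) + (t + 1) * (H + (h + 4)) + (t + 1))) :=
    hA₁.sdiff hZ₁E hZ₁c.le (by nlinarith) (by nlinarith)
  obtain ⟨S₂, hS₂, hS₂E, hflex⟩ := hJ.exists_flex hH hx hy (fun c l => w c (some l))
    (by
      intro i j hij
      have := hw (a₁ := (i.1, some i.2)) (a₂ := (j.1, some j.2)) hij
      simp only [Prod.mk.injEq, Option.some.injEq] at this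
      exact Prod.ext this.1 this.2)
    (A := (A \ Z₀) \ Z₁) (E := E) (fun i hi => hxA i (sdiff_subset (sdiff_subset hi))) e
    ⟨hA₂.deg, le_trans (by rw [hcard]; nlinarith) hA₂.size⟩
  have hd₁ : Disjoint Z₀ Z₁ := (disjoint_of_subset_left hZ₁ sdiff_disjoint).symm
  have hd₂ : Disjoint (Z₀ ∪ Z₁) S₂ := by
    rw [sdiff_sdiff_left] at hS₂
    exact (disjoint_of_subset_left hS₂ sdiff_disjoint).symm
  set S := Z₀ ∪ Z₁ ∪ S₂ with hS
  have hwS : ∀ c o, w c o ∈ S := fun c o =>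
    mem_union_left _ (mem_union_left _ (mem_map.2 ⟨(c, o), mem_univ _, rfl⟩))
  have hSval : S.val = Z₀.val + Z₁.val + S₂.val := by
    rw [hS, union_val_of_disjoint hd₂, union_val_of_disjoint hd₁]
  -- The leaves of a star number `t + 1`, so joinedness applies to them directly.
  have hmiss : ∀ (M : Finset V) (c), Disjoint M S → (∀ v ∈ M, ∀ l, ¬ G.Adj v (w c (some l))) →
      #M < t + 1 := by
    intro M c hM h
    by_contra! hc
    have hi : Function.Injective fun l => w c (some l) := by
      intro l l' hl
      have := hw (a₁ := (c, some l)) (a₂ := (c, some l')) hl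
      simpa using this
    obtain ⟨u, hu, v, hv, huv⟩ := hJ M (univ.map ⟨_, hi⟩) (disjoint_of_subset_right (by
        intro v hv
        obtain ⟨l, -, rfl⟩ := mem_map.1 hv
        exact hwS _ _) hM) hc (by simp)
    obtain ⟨l, -, rfl⟩ := mem_map.1 hv
    exact h u hu l huv
  -- These vertices miss at least a third of the stars on one side. Each star is missed by at most
  -- `t + 1` of them, so double counting bounds their number.
  set bad : Bool → Finset V := fun β =>
    {v ∈ Sᶜ | (q + 2) / 3 ≤ #{c : Fin q | ∀ l, ¬ G.Adj v (w (c, β) (some l))}} with hbad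
  have hbadc : ∀ β, #(bad β) ≤ 3 * (t + 1) := by
    intro β
    have := card_mul_le_card_mul (s := bad β) (t := univ) (m := (q + 2) / 3) (n := t + 1)
      (fun v (c : Fin q) => ∀ l, ¬ G.Adj v (w (c, β) (some l)))
      (fun v hv => (mem_filter.1 hv).2)
      (fun c _ => (hmiss _ (c, β) (by
        rw [disjoint_left]
        intro v hv
        exact mem_compl.1 (mem_filter.1 (mem_filter.1 hv).1).1)
        fun v hv => (mem_filter.1 hv).2).le)
    rw [card_univ, Fintype.card_fin] at this
    by_contra! hc
    have h1 : (3 * (t + 1) + 1) * ((q + 2) / 3) ≤ q * (t + 1) :=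
      (Nat.mul_le_mul_right _ hc).trans this
    have h2 : q ≤ 3 * ((q + 2) / 3) := by omega
    have h3 : 0 < (q + 2) / 3 := by omega
    nlinarith
  refine ⟨S, ?_, ?_, bad false ∪ bad true, ?_, ?_, ?_⟩
  · exact union_subset (union_subset (hZ₀A.trans sdiff_subset) (hZ₁.trans sdiff_subset))
      (hS₂.trans (sdiff_subset.trans sdiff_subset))
  · rw [hS, union_inter_distrib_right, union_inter_distrib_right, hZ₀E, empty_union]
    have := card_union_le (Z₁ ∩ E) (S₂ ∩ E)
    nlinarith
  · have := card_union_le (bad false) (bad true)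
    have h1 := hbadc false
    have h2 := hbadc true
    omega
  · have h1 := (hflex fun _ => 0).card
    simp only [Multiset.card_add, Multiset.card_sum, Multiset.card_singleton, sum_const, card_univ,
      hcard, Fintype.card_fin, smul_eq_mul, mul_one] at h1
    rw [hS, card_union_of_disjoint hd₂, card_union_of_disjoint hd₁, hZ₀c, hZ₁c]
    rw [← card_def] at h1
    rw [← h1]
    ring
  · intro a b ha hb haS hbS
    set r : Fin q → Finset (Fin q) := fun i => {c | (∃ l, G.Adj (a i) (w (c, false) (some l))) ∧
      ∃ l, G.Adj (b i) (w (c, true) (some l))} with hr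
    -- Hall's condition. A single pair misses less than a third of the stars on each side, leaving
    -- at least `2 * (t + 1)` choices. For `2 * (t + 1)` or more pairs every index occurs, since it
    -- is missed by at most `t` starts and at most `t` ends.
    have hall : ∀ s : Finset (Fin q), #s ≤ #(s.biUnion r) := by
      intro s
      rcases s.eq_empty_or_nonempty with rfl | ⟨i, hi⟩
      · simp
      rcases Nat.lt_or_ge (#s) (2 * (t + 1)) with hs | hs
      · have h1 : ∀ β (v : V), v ∉ S ∪ (bad false ∪ bad true) →
            #{c : Fin q | ∀ l, ¬ G.Adj v (w (c, β) (some l))} < (q + 2) / 3 := by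
          intro β v hv
          by_contra! h
          have : v ∈ bad β := mem_filter.2 ⟨mem_compl.2 fun hvS =>
            hv (mem_union_left _ hvS), h⟩
          apply hv
          cases β <;> simp [this]
        have h2 := h1 false _ (haS i)
        have h3 := h1 true _ (hbS i)
        set M₁ : Finset (Fin q) := {c | ∀ l, ¬ G.Adj (a i) (w (c, false) (some l))} with hM₁
        set M₂ : Finset (Fin q) := {c | ∀ l, ¬ G.Adj (b i) (w (c, true) (some l))} with hM₂
        have h4 : univ \ (M₁ ∪ M₂) ⊆ r i := by
          intro c hc
          simpa [hr, hM₁, hM₂] using hc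
        have h5 := card_le_card h4
        have h6 := le_card_sdiff (M₁ ∪ M₂) univ
        have h7 := card_union_le M₁ M₂
        have h8 := card_le_card (subset_biUnion_of_mem r hi)
        rw [card_univ, Fintype.card_fin] at h6
        omega
      · have h1 : ∀ c, c ∈ s.biUnion r := by
          intro c
          have h2 : ∀ (f : Fin q → V) β, Function.Injective f →
              (∀ j, f j ∉ S ∪ (bad false ∪ bad true)) →
              #{i ∈ s | ∀ l, ¬ G.Adj (f i) (w (c, β) (some l))} < t + 1 := by
            intro f β hf hfS
            rw [← card_image_of_injective _ hf]
            refine hmiss _ (c, β) ?_ ?_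
            · rw [disjoint_left]
              intro v hv
              obtain ⟨j, -, rfl⟩ := mem_image.1 hv
              exact fun h => hfS j (mem_union_left _ h)
            · intro v hv
              obtain ⟨j, hj, rfl⟩ := mem_image.1 hv
              exact (mem_filter.1 hj).2
          have h3 := h2 a false ha haS
          have h4 := h2 b true hb hbS
          obtain ⟨j, hj⟩ : (s \ ({i ∈ s | ∀ l, ¬ G.Adj (a i) (w (c, false) (some l))} ∪
              {i ∈ s | ∀ l, ¬ G.Adj (b i) (w (c, true) (some l))})).Nonempty := by
            rw [← card_pos]
            have h6 := le_card_sdiff ({i ∈ s | ∀ l, ¬ G.Adj (a i) (w (c, false) (some l))} ∪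
              {i ∈ s | ∀ l, ¬ G.Adj (b i) (w (c, true) (some l))}) s
            have h7 := card_union_le {i ∈ s | ∀ l, ¬ G.Adj (a i) (w (c, false) (some l))}
              {i ∈ s | ∀ l, ¬ G.Adj (b i) (w (c, true) (some l))}
            omega
          simp only [mem_sdiff, mem_union, mem_filter, not_or, not_and, not_forall, not_not] at hj
          exact mem_biUnion.2 ⟨j, hj.1, mem_filter.2 ⟨mem_univ _, hj.2.1 hj.1, hj.2.2 hj.1⟩⟩
        rw [eq_univ_of_forall h1]
        exact card_le_univ s
    obtain ⟨f, hf, hfr⟩ := (all_card_le_biUnion_card_iff_exists_injective r).1 hall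
    set σ := Equiv.ofBijective f (Finite.injective_iff_bijective.1 hf) with hσ
    have hσr : ∀ i, (∃ l, G.Adj (a i) (w (σ i, false) (some l))) ∧
        ∃ l, G.Adj (b i) (w (σ i, true) (some l)) := fun i => (mem_filter.1 (hfr i)).2
    choose la hla using fun i => (hσr i).1
    choose lb hlb using fun i => (hσr i).2
    -- The leaf through which a link enters or leaves a star is the vertex that its flexible class
    -- omits.
    refine ⟨fun i => (w (σ i, false) (some (la i)) :: w (σ i, false) none :: z (σ i) ++
        [w (σ i, true) none]) ++ [w (σ i, true) (some (lb i))], fun i => ?_, _,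
      hflex fun c => if c.2 then lb (σ.symm c.1) else la (σ.symm c.1), ?_⟩
    · have := ((((hz (σ i)).cons (hwG (σ i, false) (la i)).symm).cons (hla i)).concat
        (hwG (σ i, true) (lb i))).concat (hlb i).symm
      simpa using this
    · set g : Fin q → Multiset V := fun c => {w (c, false) (some (la (σ.symm c)))} +
        {w (c, false) none} + (z c : Multiset V) + {w (c, true) none} +
        {w (c, true) (some (lb (σ.symm c)))} with hg
      have h1 : ∀ i, (((w (σ i, false) (some (la i)) :: w (σ i, false) none :: z (σ i) ++
          [w (σ i, true) none]) ++ [w (σ i, true) (some (lb i))] : List V) : Multiset V) =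
          g (σ i) := by
        intro i
        simp only [hg, ← Multiset.coe_add, ← Multiset.cons_coe, ← Multiset.singleton_add,
          Multiset.coe_nil, Equiv.symm_apply_apply]
        abel
      rw [sum_congr rfl fun i _ => h1 i, Equiv.sum_comp σ g, hSval, hZ₀, map_univ_val, ← hzs]
      simp only [hg, Function.Embedding.coeFn_mk, Fintype.sum_prod_type, Fintype.sum_bool,
        Fintype.sum_option, sum_add_distrib]
      have h2 : ∀ β (g : Fin q → Fin (t + 1)),
          ∑ c, ∑ l, ({w (c, β) (some l)} : Multiset V) = ∑ c, {w (c, β) (some (g c))} +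
            ∑ c, ∑ j : Fin t, {w (c, β) (some ((g c).succAbove j))} := by
        intro β g
        rw [← sum_add_distrib]
        exact sum_congr rfl fun c _ => Fin.sum_univ_succAbove _ (g c)
      rw [h2 true fun c => lb (σ.symm c), h2 false fun c => la (σ.symm c)]
      simp only [if_true, if_false, Bool.false_eq_true]
      abel

/-! ### Composition of linkers -/

/-- Greedily linking pairs through levels consisting of disjoint classes, using one class of each
level for each pair. -/
theorem Joined.exists_greedy_links {m K j : ℕ} (hm : 0 < m) (hK : 0 < K) (hJ : Joined G m)
    (hj : 0 < j) (hmK : m ≤ K ^ j) {L β s t N : ℕ} (hL : 2 * j ≤ L)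
    (hβ : (K + 1) * m ≤ β * t) (hN : 2 * m + s ≤ N) (v : Fin L × Fin (s + β) → Fin t → V)
    (hv : Function.Injective fun q : (Fin L × Fin (s + β)) × Fin t => v q.1 q.2)
    {a b : Fin N → V} (ha : Function.Injective a) (hb : Function.Injective b)
    (hav : ∀ i c o, a i ≠ v c o) (hbv : ∀ i c o, b i ≠ v c o) :
    ∃ D : Finset (Fin N), #D = s ∧ ∃ (g : Fin N → Fin L → Fin (s + β)) (o : Fin N → Fin L → Fin t),
      (∀ i ∈ D, IsLink G (a i) (b i) L (List.ofFn fun l => v (l, g i l) (o i l))) ∧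
      ∀ l, Set.InjOn (fun i => g i l) D := by
  have hβ0 : 0 < β * t := lt_of_lt_of_le (Nat.mul_pos (by omega) hm) hβ
  have ht : 0 < t := Nat.pos_of_mul_pos_left hβ0
  have hβ1 : 0 < β := Nat.pos_of_mul_pos_right hβ0
  have key : ∀ n ≤ s, ∃ D : Finset (Fin N), #D = n ∧
      ∃ (g : Fin N → Fin L → Fin (s + β)) (o : Fin N → Fin L → Fin t),
      (∀ i ∈ D, IsLink G (a i) (b i) L (List.ofFn fun l => v (l, g i l) (o i l))) ∧
      ∀ l, Set.InjOn (fun i => g i l) D := by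
    intro n
    induction n with
    | zero =>
      exact fun _ => ⟨∅, rfl, fun _ _ => ⟨0, by omega⟩, fun _ _ => ⟨0, ht⟩, by simp, by simp⟩
    | succ n ih =>
      intro hn
      obtain ⟨D, hD, g, o, hgo, hg⟩ := ih (by omega)
      -- Classes still free in each level: fewer than `s` links exist and each occupies one class
      -- per level, so at least `β` remain.
      set F : Fin L → Finset (Fin (s + β)) := fun l => (D.image fun i => g i l)ᶜ with hF
      have hFc : ∀ l, β ≤ #(F l) := fun l => by
        have := card_image_le (s := D) (f := fun i => g i l)
        rw [hF, card_compl, Fintype.card_fin]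
        omega
      set U : ℕ → Finset V := fun l => if h : l < L then
        (F ⟨l, h⟩ ×ˢ (univ : Finset (Fin t))).image fun q => v (⟨l, h⟩, q.1) q.2 else ∅ with hU
      have hmemU : ∀ l (h : l < L) w, w ∈ U l ↔ ∃ c ∈ F ⟨l, h⟩, ∃ r, v (⟨l, h⟩, c) r = w := by
        intro l h w
        simp only [hU, h, dif_pos, mem_image, mem_product, mem_univ, and_true, Prod.exists]
        exact ⟨fun ⟨c, r, hc, e⟩ => ⟨c, hc, r, e⟩, fun ⟨c, hc, r, e⟩ => ⟨c, r, hc, e⟩⟩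
      obtain ⟨i, hi, p, hp, hpU⟩ := hJ.exists_linked_pair hm hK hj hL hmK (U := U)
        (fun l hl => by
          simp only [hU, hl, dif_pos]
          rw [card_image_of_injective _ (fun q q' h => by
            have := hv (a₁ := ((⟨l, hl⟩, q.1), q.2)) (a₂ := ((⟨l, hl⟩, q'.1), q'.2)) h
            simp only [Prod.mk.injEq, true_and] at this
            exact Prod.ext this.1 this.2), card_product, card_univ, Fintype.card_fin]
          exact hβ.trans (Nat.mul_le_mul_right t (hFc _)))
        (fun l l' hll hl' => by
          rw [disjoint_left]
          intro w hw hw'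
          obtain ⟨c, -, r, rfl⟩ := (hmemU l (by omega) w).1 hw
          obtain ⟨c', -, r', h⟩ := (hmemU l' hl' _).1 hw'
          have := hv (a₁ := ((⟨l', hl'⟩, c'), r')) (a₂ := ((⟨l, by omega⟩, c), r)) h
          simp only [Prod.mk.injEq, Fin.mk.injEq] at this
          omega)
        Dᶜ (by rw [card_compl, Fintype.card_fin]; omega) a b ha.injOn hb.injOn
        (fun i _ l hl h => by
          obtain ⟨c, -, r, h⟩ := (hmemU l hl _).1 h
          exact hav _ _ _ h.symm)
        (fun i _ l hl h => by
          obtain ⟨c, -, r, h⟩ := (hmemU l hl _).1 h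
          exact hbv _ _ _ h.symm)
      have hp1 := hp.1
      have hch : ∀ l : Fin L, ∃ c ∈ F l, ∃ r, v (l, c) r = p[(l : ℕ)] := fun l =>
        (hmemU l l.2 _).1 (hpU l (by omega))
      choose g₀ hg₀ o₀ ho₀ using hch
      have hpe : p = List.ofFn fun l => v (l, g₀ l) (o₀ l) := by
        refine List.ext_getElem (by simp [hp1]) fun k h₁ h₂ => ?_
        rw [List.getElem_ofFn]
        exact (ho₀ ⟨k, by omega⟩).symm
      rw [mem_compl] at hi
      refine ⟨insert i D, by rw [card_insert_of_notMem hi, hD], Function.update g i g₀,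
        Function.update o i o₀, fun k hk => ?_, fun l => ?_⟩
      · rcases mem_insert.1 hk with rfl | hk
        · simpa [← hpe] using hp
        · have : k ≠ i := ne_of_mem_of_not_mem hk hi
          rw [Function.update_of_ne this, Function.update_of_ne this]
          exact hgo k hk
      · have hne : ∀ k ∈ D, Function.update g i g₀ k = g k := fun k hk =>
          Function.update_of_ne (ne_of_mem_of_not_mem hk hi) _ _
        have hnF : ∀ k ∈ D, g k l ≠ g₀ l := fun k hk h => by
          have := hg₀ l
          rw [hF, mem_compl, ← h] at this
          exact this (mem_image_of_mem (fun i => g i l) hk)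
        intro k hk k' hk' h
        simp only [coe_insert, Set.mem_insert_iff, mem_coe] at hk hk'
        rcases hk with rfl | hk <;> rcases hk' with rfl | hk'
        · rfl
        · simp only [hne k' hk', Function.update_self] at h
          exact absurd h.symm (hnF k' hk')
        · simp only [hne k hk, Function.update_self] at h
          exact absurd h (hnF k hk)
        · simp only [hne k hk, hne k' hk'] at h
          exact hg l hk hk' h
  exact key s le_rfl

theorem coe_ofFn {α : Type*} {n : ℕ} (f : Fin n → α) :
    (List.ofFn f : Multiset α) = ∑ l, {f l} := by
  rw [← Fin.univ_val_map, ← Multiset.sum_map_singleton (Multiset.map f univ.val),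
    Multiset.map_map]
  rfl

theorem sum_equiv_coe {ι κ M : Type*} [Fintype ι] [AddCommMonoid M] {s : Finset κ} (e : ι ≃ s)
    (f : κ → M) : ∑ i, f (e i) = ∑ k ∈ s, f k := by
  rw [← sum_coe_sort s f]
  exact Equiv.sum_comp e fun k => f k

/-- Levels of flexible classes together with two linkers for fewer pairs form a linker. -/
theorem Joined.exists_linker_compose {m K j : ℕ} (hm : 0 < m) (hK : 0 < K) (hJ : Joined G m)
    (hj : 0 < j) (hmK : m ≤ K ^ j) {κ : Type*} [DecidableEq κ] {x y : κ → V}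
    {H L L₁ L₂ β s t : ℕ} (hL : 2 * j ≤ L) (hβ : (K + 1) * m ≤ β * (t + 1))
    (hN : 2 * m ≤ L * β) (hLdef : L = L₁ + 1 + L₂) (v : Fin L × Fin (s + β) → Fin (t + 1) → V)
    (hv : Function.Injective
      fun q : (Fin L × Fin (s + β)) × Fin (t + 1) => v q.1 q.2)
    {S₀ S₁ S₂ B₁ B₂ : Finset V} {I₀ I₁ I₂ : Finset κ}
    (hflex : ∀ r : Fin L × Fin (s + β) → Fin (t + 1), Routes G x y H I₀
      (S₀.val + ∑ c, ∑ i : Fin t, {v c ((r c).succAbove i)}))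
    (h₁ : Linker G x y H (L * β) L₁ S₁ I₁ B₁)
    (h₂ : Linker G x y H (L * β) L₂ S₂ I₂ B₂)
    (hvS : ∀ c o, v c o ∉ S₀ ∪ S₁ ∪ S₂ ∪ (B₁ ∪ B₂)) (hS₀₁ : Disjoint S₀ S₁)
    (hS₂ : Disjoint (S₀ ∪ S₁) S₂) (hI₀₁ : Disjoint I₀ I₁) (hI₂ : Disjoint (I₀ ∪ I₁) I₂) :
    Linker G x y H (L * β + s) L
      (univ.map ⟨_, hv⟩ ∪ (S₀ ∪ S₁ ∪ S₂)) (I₀ ∪ I₁ ∪ I₂) (B₁ ∪ B₂) := by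
  have hd : Disjoint (univ.map ⟨_, hv⟩) (S₀ ∪ S₁ ∪ S₂) := by
    rw [disjoint_left]
    intro w hw hw'
    obtain ⟨q, -, rfl⟩ := mem_map.1 hw
    exact hvS q.1 q.2 (mem_union_left _ hw')
  constructor
  · have h0 := (hflex fun _ => 0).card
    simp only [Multiset.card_add, Multiset.card_sum, Multiset.card_singleton, sum_const, card_univ,
      Fintype.card_fin, Fintype.card_prod, smul_eq_mul, mul_one] at h0
    rw [← card_def] at h0
    rw [card_union_of_disjoint hd, card_union_of_disjoint hS₂, card_union_of_disjoint hS₀₁,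
      card_union_of_disjoint hI₂, card_union_of_disjoint hI₀₁, h₁.card, h₂.card, card_map,
      card_univ]
    simp only [Fintype.card_fin, Fintype.card_prod]
    have e : L * (s + β) * (t + 1) = L * (s + β) + L * (s + β) * t := by ring
    have e' : (L * β + s) * L = L * (s + β) + L * β * L₁ + L * β * L₂ := by
      rw [hLdef]; ring
    rw [e, e', Nat.add_mul (#I₀ + #I₁), Nat.add_mul, ← h0]
    ring
  · intro a b ha hb haS hbS
    have hZ : ∀ c o, v c o ∈ univ.map ⟨_, hv⟩ := fun c o => mem_map.2 ⟨(c, o), mem_univ _, rfl⟩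
    obtain ⟨D, hD, g, o, hgo, hg⟩ := hJ.exists_greedy_links hm hK hj hmK hL hβ
      (show 2 * m + s ≤ L * β + s by omega) v hv ha hb
      (fun i c o h => haS i (by rw [h]; exact mem_union_left _ (mem_union_left _ (hZ c o))))
      (fun i c o h => hbS i (by rw [h]; exact mem_union_left _ (mem_union_left _ (hZ c o))))
    set used : Finset (Fin L × Fin (s + β)) := (D ×ˢ univ).image fun q => (q.2, g q.1 q.2)
      with hused
    have husedi : Set.InjOn (fun q : Fin (L * β + s) × Fin L => (q.2, g q.1 q.2))
        (D ×ˢ (univ : Finset (Fin L)) : Finset _) := by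
      intro q hq q' hq' h
      simp only [coe_product, Set.mem_prod, mem_coe] at hq hq'
      simp only [Prod.mk.injEq] at h
      refine Prod.ext (hg q.2 hq.1 hq'.1 ?_) h.1
      have := h.2
      rw [← h.1] at this
      exact this
    have hDc : #Dᶜ = L * β := by
      rw [card_compl, hD, Fintype.card_fin]; omega
    -- The count that makes the construction exact: there are as many unused classes as unlinked
    -- pairs.
    have husedc : #usedᶜ = L * β := by
      rw [card_compl, hused, card_image_of_injOn husedi, card_product, hD, card_univ]
      simp only [Fintype.card_fin, Fintype.card_prod]
      rw [Nat.mul_add, Nat.mul_comm s L]; omega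
    have eD := (Dᶜ.equivFinOfCardEq hDc).symm
    have eU := (usedᶜ.equivFinOfCardEq husedc).symm
    -- the choice of one vertex in each class
    have hr : ∃ r : Fin L × Fin (s + β) → Fin (t + 1), ∀ i ∈ D, ∀ l, r (l, g i l) = o i l := by
      classical
      refine ⟨fun c => if h : ∃ i ∈ D, g i c.1 = c.2 then o h.choose c.1 else 0,
        fun i hi l => ?_⟩
      have h : ∃ k ∈ D, g k l = g i l := ⟨i, hi, rfl⟩
      simp only [h, dif_pos]
      rw [hg l h.choose_spec.1 hi h.choose_spec.2]
    obtain ⟨r, hr⟩ := hr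
    -- Every unused class also gives up one vertex, as the meeting point of two smaller links; now
    -- each class omits exactly one vertex, as flexibility requires.
    set w : Fin (L * β) → V := fun k => v (eU k) (r (eU k)) with hw
    have hwi : Function.Injective w := by
      intro k k' h
      have := hv (a₁ := ((eU k : Fin L × Fin (s + β)), r (eU k)))
        (a₂ := ((eU k' : Fin L × Fin (s + β)), r (eU k'))) h
      simp only [Prod.mk.injEq] at this
      exact eU.injective (Subtype.ext this.1)
    have hwS : ∀ k, w k ∉ S₁ ∪ B₁ ∧ w k ∉ S₂ ∪ B₂ := fun k => by
      have := hvS (eU k) (r (eU k))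
      simp only [mem_union, not_or] at this ⊢
      tauto
    have haS' : ∀ i, a i ∉ S₁ ∪ B₁ := fun i => by
      have := haS i
      simp only [mem_union, not_or] at this ⊢
      tauto
    have hbS' : ∀ i, b i ∉ S₂ ∪ B₂ := fun i => by
      have := hbS i
      simp only [mem_union, not_or] at this ⊢
      tauto
    have hei : Function.Injective fun k => (eD k : Fin (L * β + s)) :=
      Subtype.val_injective.comp eD.injective
    obtain ⟨p₁, hp₁, T₁, hT₁, hs₁⟩ := h₁.link (fun k => a (eD k)) w (ha.comp hei) hwi
      (fun k => haS' _) (fun k => (hwS k).1)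
    obtain ⟨p₂, hp₂, T₂, hT₂, hs₂⟩ := h₂.link w (fun k => b (eD k)) hwi (hb.comp hei)
      (fun k => (hwS k).2) (fun k => hbS' _)
    set P : Fin (L * β + s) → List V := fun i => if h : i ∈ Dᶜ then
      p₁ (eD.symm ⟨i, h⟩) ++ w (eD.symm ⟨i, h⟩) :: p₂ (eD.symm ⟨i, h⟩)
      else List.ofFn fun l => v (l, g i l) (o i l) with hP
    have hPe : ∀ k, P (eD k) = p₁ k ++ w k :: p₂ k := fun k => by
      simp only [hP, (eD k).2, dif_pos, Subtype.coe_eta, Equiv.symm_apply_apply]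
    have hPD : ∀ i ∈ D, P i = List.ofFn fun l => v (l, g i l) (o i l) := fun i hi => by
      have : i ∉ Dᶜ := by simpa using hi
      simp only [hP, this, dif_neg, not_false_eq_true]
    refine ⟨P, fun i => ?_, _, ((hflex r).union hT₁ hI₀₁).union hT₂ hI₂, ?_⟩
    · by_cases hi : i ∈ D
      · rw [hPD i hi]; exact hgo i hi
      · obtain ⟨k, hk⟩ := eD.surjective ⟨i, mem_compl.2 hi⟩
        have hk' : (eD k : Fin (L * β + s)) = i := by rw [hk]
        rw [← hk', hPe k]
        have := (hp₁ k).append (hp₂ k)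
        rwa [← hLdef] at this
    · have e1 : ∑ i ∈ D, (P i : Multiset V) = ∑ c ∈ used, {v c (r c)} := by
        rw [hused, sum_image husedi, sum_product]
        refine sum_congr rfl fun i hi => ?_
        rw [hPD i hi, coe_ofFn]
        exact sum_congr rfl fun l _ => by rw [hr i hi l]
      have e2 : ∑ i ∈ Dᶜ, (P i : Multiset V) = ∑ k, (p₁ k : Multiset V) + ∑ k, {w k} +
          ∑ k, (p₂ k : Multiset V) := by
        rw [← sum_equiv_coe eD, ← sum_add_distrib, ← sum_add_distrib]
        refine sum_congr rfl fun k _ => ?_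
        rw [hPe k]
        simp only [← Multiset.coe_add, ← Multiset.cons_coe, ← Multiset.singleton_add]
        abel
      have e3 : ∑ k, ({w k} : Multiset V) = ∑ c ∈ usedᶜ, {v c (r c)} :=
        sum_equiv_coe eU fun c => ({v c (r c)} : Multiset V)
      have e4 : ∑ c, ∑ l, ({v c l} : Multiset V) = ∑ c, {v c (r c)} +
          ∑ c, ∑ i : Fin t, {v c ((r c).succAbove i)} := by
        rw [← sum_add_distrib]
        exact sum_congr rfl fun c _ => Fin.sum_univ_succAbove _ (r c)
      have e5 : ∑ q : (Fin L × Fin (s + β)) × Fin (t + 1), ({v q.1 q.2} : Multiset V) =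
          ∑ c, ∑ l, {v c l} := Fintype.sum_prod_type _
      rw [union_val_of_disjoint hd, union_val_of_disjoint hS₂, union_val_of_disjoint hS₀₁,
        map_univ_val]
      simp only [Function.Embedding.coeFn_mk]
      rw [e5, e4, ← sum_add_sum_compl used fun c => ({v c (r c)} : Multiset V),
        ← sum_add_sum_compl D, e1, e2, e3, ← hs₁, ← hs₂]
      abel

/-! ### Linkers for many pairs at low cost -/

theorem exists_embedding_into {α κ : Type*} [Fintype α] (I : Finset κ)
    (h : Fintype.card α ≤ #I) : ∃ e : α ↪ κ, univ.map e ⊆ I := by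
  obtain ⟨e⟩ := Function.Embedding.nonempty_of_card_le (α := α) (β := I) (by simpa using h)
  refine ⟨e.trans (Function.Embedding.subtype _), fun k hk => ?_⟩
  obtain ⟨a, -, rfl⟩ := mem_map.1 hk
  exact (e a).2

set_option maxHeartbeats 1000000 in
/-- Linkers exist for families of many pairs. -/
theorem Joined.exists_linker [Fintype V] {m K j : ℕ} (hm : 0 < m) (hK : 0 < K) (hJ : Joined G m)
    (hj : 0 < j) (hmK : m ≤ K ^ j) {κ : Type*} [DecidableEq κ] {x y : κ → V}
    (hx : Function.Injective x) (hy : Function.Injective y) {H L L₁ L₂ s : ℕ} (hH : 18 ≤ H)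
    (hLH : L ≤ H) (hLdef : L = L₁ + 1 + L₂) (hL₁ : 6 ≤ L₁) (hL₂ : 6 ≤ L₂) (hL : 2 * j ≤ L)
    {A E : Finset V} (hxA : ∀ i, x i ∉ A) (I : Finset κ)
    (hI : 4 * L * m * m + L * (s + m) * K ≤ #I)
    (hA : Avail G A E (4 * m * (3 * H + L) + 2 * m)
      (10 * (L * m * m * H) + 2 * (L * (s + m) * (K + 1) * H))) :
    ∃ S ⊆ A, #(S ∩ E) ≤ 4 * m * (3 * H + L) ∧ ∃ I' ⊆ I, #I' ≤ 4 * L * m * m + L * (s + m) * K ∧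
      ∃ B : Finset V, #B ≤ 12 * m ∧ Linker G x y H (L * m + s) L S I' B := by
  obtain ⟨t, rfl⟩ : ∃ t, m = t + 1 := ⟨m - 1, by omega⟩
  -- Each core linker serves `L * β` pairs with `β = m`, the number left over by the greedy step.
  set Q := L * (t + 1) with hQ
  set M := L * (t + 1) * (t + 1) * H with hM
  clear_value M Q
  have htH : 18 * (t + 1) ≤ (t + 1) * H := by rw [mul_comm]; gcongr
  have huH : 18 * ((t + 1) * (t + 1)) ≤ (t + 1) * ((t + 1) * H) := by
    calc 18 * ((t + 1) * (t + 1)) = (t + 1) * (18 * (t + 1)) := by ring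
      _ ≤ (t + 1) * ((t + 1) * H) := by gcongr
  have htH' : (t + 1) * H ≤ (t + 1) * ((t + 1) * H) := Nat.le_mul_of_pos_left _ hm
  have htt : t + 1 ≤ (t + 1) * (t + 1) := Nat.le_mul_of_pos_left _ hm
  have hM13 : 13 * ((t + 1) * ((t + 1) * H)) ≤ M := by
    calc 13 * ((t + 1) * ((t + 1) * H)) ≤ L * ((t + 1) * ((t + 1) * H)) := by gcongr; omega
      _ = M := by rw [hM]; ring
  have hbound : ∀ h, h ≤ H → 2 * Q * ((t + 1) * H + h + (t + 2)) +
      4 * ((t + 1) * (t + 1) + (t + 1) * (H + h) + (t + 1)) ≤ 7 * M := by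
    intro h hh
    have e1 : Q * h ≤ M := by
      calc Q * h ≤ Q * ((t + 1) * H) := by
            gcongr; exact hh.trans (Nat.le_mul_of_pos_left _ hm)
        _ = M := by rw [hM, hQ]; ring
    have e2 : Q * (t + 2) ≤ M := by
      calc Q * (t + 2) ≤ Q * ((t + 1) * H) := by gcongr; omega
        _ = M := by rw [hM, hQ]; ring
    have e3 : 4 * ((t + 1) * (t + 1) + (t + 1) * (H + h) + (t + 1)) ≤ M := by
      have : (t + 1) * (H + h) ≤ 2 * ((t + 1) * H) := by
        calc (t + 1) * (H + h) ≤ (t + 1) * (H + H) := by gcongr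
          _ = 2 * ((t + 1) * H) := by ring
      omega
    have e4 : Q * ((t + 1) * H) = M := by rw [hM, hQ]; ring
    have e5 : 2 * Q * ((t + 1) * H + h + (t + 2)) =
        2 * (Q * ((t + 1) * H)) + 2 * (Q * h) + 2 * (Q * (t + 2)) := by ring
    omega
  have hcardS : ∀ (S : Finset V) (I' : Finset κ) (h : ℕ), h ≤ H → #I' = 2 * Q * t →
      #S = Q * h + #I' * H → #S ≤ 3 * M := by
    intro S I' h hh hI' hS
    have e1 : Q * h ≤ M := by
      calc Q * h ≤ Q * ((t + 1) * H) := by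
            gcongr; exact hh.trans (Nat.le_mul_of_pos_left _ hm)
        _ = M := by rw [hM, hQ]; ring
    have e2 : 2 * Q * t * H ≤ 2 * M := by
      calc 2 * Q * t * H ≤ 2 * Q * (t + 1) * H := by gcongr; omega
        _ = 2 * M := by rw [hM, hQ]; ring
    rw [hS, hI']; omega
  have hQ6 : 6 * (t + 1) ≤ Q := by
    rw [hQ]; exact Nat.mul_le_mul_right _ (by omega)
  have hcardI : 4 * L * (t + 1) * (t + 1) = 4 * Q * t + 4 * Q := by rw [hQ]; ring
  set R := L * (s + (t + 1)) with hR
  clear_value R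
  have hRR : R * (K + 1) = R * K + R := by ring
  -- the first linker
  have hty : Fintype.card ((Fin Q × Bool) × Fin t) = 2 * Q * t := by
    simp only [Fintype.card_prod, Fintype.card_fin, Fintype.card_bool]; ring
  obtain ⟨e₁, he₁⟩ := exists_embedding_into (α := (Fin Q × Bool) × Fin t) I (by
    have : 4 * Q * t = 2 * Q * t + 2 * Q * t := by ring
    omega)
  set I₁ := univ.map e₁ with hI₁
  have hI₁c : #I₁ = 2 * Q * t := by rw [hI₁, card_map, card_univ, hty]
  obtain ⟨S₁, hS₁, hS₁E, B₁, hB₁, hl₁⟩ := hJ.exists_linker_core hH hL₁ hQ6 hx hy hxA e₁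
    (E := E) ⟨fun v => le_trans (by gcongr <;> omega) (hA.deg v),
      le_trans (le_trans (hbound L₁ (by omega)) (by omega)) hA.size⟩
  have hS₁c := hcardS S₁ I₁ L₁ (by omega) hI₁c hl₁.card
  have hA₁ : Avail G (A \ S₁) E (4 * (t + 1) * (2 * H + 1 + L₂) + 2 * (t + 1))
      (7 * M + 2 * (R * (K + 1) * H)) :=
    hA.sdiff hS₁E hS₁c (by rw [hLdef]; exact le_of_eq (by ring)) (by omega)
  -- the second linker
  obtain ⟨e₂, he₂⟩ := exists_embedding_into (α := (Fin Q × Bool) × Fin t) (I \ I₁) (by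
    rw [hty, card_sdiff_of_subset he₁, hI₁c]
    have : 4 * Q * t = 2 * Q * t + 2 * Q * t := by ring
    omega)
  set I₂ := univ.map e₂ with hI₂
  have hI₂c : #I₂ = 2 * Q * t := by rw [hI₂, card_map, card_univ, hty]
  obtain ⟨S₂, hS₂, hS₂E, B₂, hB₂, hl₂⟩ := hJ.exists_linker_core hH hL₂ hQ6 hx hy
    (fun i hi => hxA i (sdiff_subset hi)) e₂
    (E := E) ⟨fun v => le_trans (by gcongr; omega) (hA₁.deg v),
      le_trans (le_trans (hbound L₂ (by omega)) (by omega)) hA₁.size⟩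
  have hS₂c := hcardS S₂ I₂ L₂ (by omega) hI₂c hl₂.card
  have hA₂ : Avail G ((A \ S₁) \ S₂) E (4 * (t + 1) * H + 2 * (t + 1))
      (4 * M + 2 * (R * (K + 1) * H)) :=
    hA₁.sdiff hS₂E hS₂c (Nat.le.intro (k := 4 * (t + 1)) (by ring)) (by omega)
  have hRH : R * (K + 1) ≤ R * (K + 1) * H := Nat.le_mul_of_pos_right _ (by omega)
  -- the classes
  have hvcard : Fintype.card ((Fin L × Fin (s + (t + 1))) × Fin (K + 1)) = R * (K + 1) := by
    simp [hR]
  -- Avoiding `B₁ ∪ B₂` makes class vertices admissible endpoints for both core linkers; avoiding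
  -- `E` keeps the degrees.
  obtain ⟨v', hv'⟩ := exists_embedding_into
    (α := (Fin L × Fin (s + (t + 1))) × Fin (K + 1)) ((((A \ S₁) \ S₂) \ E) \ (B₁ ∪ B₂)) (by
      have h1 := le_card_sdiff (B₁ ∪ B₂) (((A \ S₁) \ S₂) \ E)
      have h2 := hA₂.size
      have h3 := card_union_le B₁ B₂
      have h4 : 12 * (t + 1) ≤ 4 * M := by omega
      rw [hvcard]
      omega)
  have hvm : ∀ c o, v' (c, o) ∈ (((A \ S₁) \ S₂) \ E) \ (B₁ ∪ B₂) := fun c o =>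
    hv' (mem_map_of_mem _ (mem_univ _))
  set Z := univ.map v' with hZ
  have hZE : Z ∩ E = ∅ := disjoint_iff_inter_eq_empty.1
    (disjoint_of_subset_left (hv'.trans sdiff_subset) sdiff_disjoint)
  have hZA : Z ⊆ (A \ S₁) \ S₂ := hv'.trans (sdiff_subset.trans sdiff_subset)
  have hZc : #Z = R * (K + 1) := by rw [hZ, card_map, card_univ, hvcard]
  have hA₃ : Avail G (((A \ S₁) \ S₂) \ Z) E (4 * (t + 1) * H + 2 * (t + 1))
      (4 * M + R * (K + 1) * H) :=
    hA₂.sdiff (s := 0) (by simp [hZE]) hZc.le (by omega) (by omega)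
  obtain ⟨e₀, he₀⟩ := exists_embedding_into (α := (Fin L × Fin (s + (t + 1))) × Fin K)
    ((I \ I₁) \ I₂) (by
      rw [card_sdiff_of_subset he₂, card_sdiff_of_subset he₁, hI₁c, hI₂c]
      have : Fintype.card ((Fin L × Fin (s + (t + 1))) × Fin K) = R * K := by simp [hR]
      have : 4 * Q * t = 2 * Q * t + 2 * Q * t := by ring
      omega)
  obtain ⟨S₀, hS₀, hS₀E, hflex⟩ := hJ.exists_flex hH hx hy (fun c o => v' (c, o)) v'.injective
    (A := ((A \ S₁) \ S₂) \ Z) (E := E)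
    (fun i hi => hxA i (sdiff_subset (sdiff_subset (sdiff_subset hi)))) e₀
    ⟨hA₃.deg, le_trans (by
      have h1 : Fintype.card (Fin L × Fin (s + (t + 1))) = R := by simp [hR]
      have h2 : R * K * H ≤ R * (K + 1) * H := by gcongr; omega
      have h3 : 2 * (t + 1) * (t + 1) = 2 * ((t + 1) * (t + 1)) := by ring
      have h4 : 2 * (t + 1) * H = 2 * ((t + 1) * H) := by ring
      rw [h1, h3, h4]
      omega) hA₃.size⟩
  have hd₀ : ∀ w ∈ S₀, w ∈ A ∧ w ∉ S₁ ∧ w ∉ S₂ ∧ w ∉ Z := fun w hw => by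
    have := hS₀ hw
    simp only [mem_sdiff] at this
    tauto
  have hIc : #(univ.map e₀) = R * K := by
    rw [card_map, card_univ]; simp [hR]
  refine ⟨Z ∪ (S₀ ∪ S₁ ∪ S₂), ?_, ?_, univ.map e₀ ∪ I₁ ∪ I₂, ?_, ?_, B₁ ∪ B₂, ?_, ?_⟩
  · exact union_subset (hZA.trans (sdiff_subset.trans sdiff_subset)) (union_subset (union_subset
      (fun w hw => (hd₀ w hw).1) hS₁) (hS₂.trans sdiff_subset))
  · rw [union_inter_distrib_right, hZE, empty_union, union_inter_distrib_right,
      union_inter_distrib_right]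
    have h1 := card_union_le (S₀ ∩ E ∪ S₁ ∩ E) (S₂ ∩ E)
    have h2 := card_union_le (S₀ ∩ E) (S₁ ∩ E)
    have h3 : 4 * (t + 1) * (3 * H + L) = 4 * (t + 1) * H + 4 * (t + 1) * (H + L₁) +
        4 * (t + 1) * (H + L₂) + 4 * (t + 1) := by rw [hLdef]; ring
    omega
  · exact union_subset (union_subset (he₀.trans (sdiff_subset.trans sdiff_subset)) he₁)
      (he₂.trans sdiff_subset)
  · have h1 := card_union_le (univ.map e₀ ∪ I₁) I₂
    have h2 := card_union_le (univ.map e₀) I₁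
    have : 4 * Q * t = 2 * Q * t + 2 * Q * t := by ring
    omega
  · have := card_union_le B₁ B₂
    omega
  · subst hQ
    refine hJ.exists_linker_compose hm hK hj hmK hL (Nat.mul_comm _ _).le ?_ hLdef
      (fun c o => v' (c, o)) v'.injective hflex hl₁ hl₂ ?_ ?_ ?_ ?_ ?_
    · exact Nat.mul_le_mul_right _ (by omega)
    · intro c o h
      have h1 := hvm c o
      simp only [mem_sdiff, mem_union, not_or] at h1 h
      rcases h with ((h | h) | h) | h
      · exact (hd₀ _ h).2.2.2 (mem_map_of_mem _ (mem_univ _))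
      all_goals tauto
    · exact disjoint_left.2 fun w hw => (hd₀ w hw).2.1
    · refine disjoint_left.2 fun w hw hw' => ?_
      rcases mem_union.1 hw with hw | hw
      · exact (hd₀ w hw).2.2.1 hw'
      · exact (mem_sdiff.1 (hS₂ hw')).2 hw
    · refine disjoint_left.2 fun w hw hw' => ?_
      have := he₀ hw
      simp only [mem_sdiff] at this
      tauto
    · refine disjoint_left.2 fun w hw hw' => ?_
      rcases mem_union.1 hw with hw | hw
      · have := he₀ hw
        simp only [mem_sdiff] at this
        tauto
      · exact (mem_sdiff.1 (he₂ hw')).2 hw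

/-! ### Assembling the spanning cover -/

/-- A small set in which all vertices have large degree. -/
theorem Joined.exists_small_dense {m D k : ℕ} [Fintype V] (hJ : Joined G m) {W : Finset V}
    (hW : ∀ v, D ≤ #(nbrIn G W {v})) (hk : m * D + 2 * m ≤ k) (hkW : k ≤ #W) :
    ∃ E ⊆ W, #E ≤ 2 * k ∧ ∀ v, D ≤ #(nbrIn G E {v}) := by
  classical
  obtain ⟨E₀, hE₀, hE₀c⟩ := exists_subset_card_eq hkW
  have hlow := hJ.card_lowDeg_lt (D := D) (U := E₀)
    (T := {v | #(nbrIn G E₀ {v}) < D}) (by omega) fun v hv => (mem_filter.1 hv).2.le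
  choose T hT hTc using fun v => exists_subset_card_eq (hW v)
  refine ⟨E₀ ∪ ({v | #(nbrIn G E₀ {v}) < D} : Finset V).biUnion T, ?_, ?_, fun v => ?_⟩
  · exact union_subset hE₀ (biUnion_subset.2 fun v _ => (hT v).trans (nbrIn_subset _ _))
  · have h1 := card_union_le E₀ (({v | #(nbrIn G E₀ {v}) < D} : Finset V).biUnion T)
    have h2 := card_biUnion_le_card_mul ({v | #(nbrIn G E₀ {v}) < D} : Finset V) T D
      fun v _ => (hTc v).le
    have h3 := Nat.mul_le_mul_right D hlow.le
    omega
  · by_cases h : D ≤ #(nbrIn G E₀ {v})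
    · exact h.trans (card_le_card (nbrIn_mono subset_union_left Subset.rfl))
    · refine (hTc v).ge.trans (card_le_card fun w hw => ?_)
      exact mem_nbrIn.2 ⟨mem_union_right _ (mem_biUnion.2 ⟨v, by simpa using h, hw⟩),
        (mem_nbrIn.1 (hT v hw)).2⟩

/-- Given pairs and vertices can be covered by paths linking the pairs. -/
theorem Joined.exists_cover {m : ℕ} (hJ : Joined G m) {κ : Type*} [DecidableEq κ] {x y : κ → V}
    (hx : Function.Injective x) (hy : Function.Injective y) {h c : ℕ} (hh : 2 ≤ h)
    {A E T : Finset V} (hT : T ⊆ A) (hTc : #T = c) {I : Finset κ} (hI : #I = c)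
    (hA : Avail G A E (c + 4 * m * (3 + h) + 2 * m)
      (c * (4 + h) + (2 * m * m + 2 * m * (3 + h) + 2 * m))) :
    ∃ S ⊆ A, T ⊆ S ∧ #S = c * (4 + h) ∧ Routes G x y (4 + h) I S.val := by
  have hA₀ : Avail G (A \ T) E (4 * m * (3 + h) + 2 * m)
      (c * (3 + h) + (2 * m * m + 2 * m * (3 + h) + 2 * m)) :=
    hA.sdiff (s := c) ((card_le_card inter_subset_left).trans hTc.le) hTc.le (by omega)
      (by nlinarith)
  have eT := (T.equivFinOfCardEq hTc).symm
  have eI := (I.equivFinOfCardEq hI).symm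
  set e : Fin c ↪ κ := eI.toEmbedding.trans (Function.Embedding.subtype _) with he
  have heI : univ.map e = I := by
    refine eq_of_subset_of_card_le (fun k hk => ?_) (by simp [hI])
    obtain ⟨i, -, rfl⟩ := mem_map.1 hk
    exact (eI i).2
  have hTi : Function.Injective fun i => (eT i : V) := Subtype.val_injective.comp eT.injective
  obtain ⟨Z₁, hZ₁, hZ₁E, hZ₁c, p, hp, hps⟩ := hJ.exists_links (ι := Fin c) (A := A \ T) (E := E)
    (h := 3) (by omega) (fun i => x (e i)) (fun i => eT i)
    (card_fiber_le_two (hx.comp e.injective)) (card_fiber_le_two hTi)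
    (fun v => le_trans (by nlinarith) (hA₀.deg v))
    (le_trans (by rw [Fintype.card_fin]; nlinarith [Nat.zero_le (c * h)]) hA₀.size)
  rw [Fintype.card_fin] at hZ₁c
  have hA₁ : Avail G ((A \ T) \ Z₁) E (4 * m * h + 2 * m)
      (c * h + (2 * m * m + 2 * m * (3 + h) + 2 * m)) :=
    hA₀.sdiff hZ₁E hZ₁c.le (by nlinarith) (by nlinarith)
  obtain ⟨Z₂, hZ₂, hZ₂E, hZ₂c, q, hq, hqs⟩ := hJ.exists_links (ι := Fin c)
    (A := (A \ T) \ Z₁) (E := E)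
    (h := h) hh (fun i => eT i) (fun i => y (e i))
    (card_fiber_le_two hTi) (card_fiber_le_two (hy.comp e.injective)) hA₁.deg
    (le_trans (by rw [Fintype.card_fin]; nlinarith) hA₁.size)
  rw [Fintype.card_fin] at hZ₂c
  have hd₁ : Disjoint T Z₁ := (disjoint_of_subset_left hZ₁ sdiff_disjoint).symm
  have hd₂ : Disjoint (T ∪ Z₁) Z₂ := by
    rw [sdiff_sdiff_left] at hZ₂
    exact (disjoint_of_subset_left hZ₂ sdiff_disjoint).symm
  refine ⟨T ∪ Z₁ ∪ Z₂, ?_, subset_union_left.trans subset_union_left, ?_, ?_⟩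
  · exact union_subset (union_subset hT (hZ₁.trans sdiff_subset))
      (hZ₂.trans (sdiff_subset.trans sdiff_subset))
  · rw [card_union_of_disjoint hd₂, card_union_of_disjoint hd₁, hTc, hZ₁c, hZ₂c]
    ring
  · have := Routes.of_embedding (G := G) (x := x) (y := y) (H := 4 + h) e
      (p := fun i => p i ++ (eT i : V) :: q i) fun i => (hp i).append (hq i)
    rw [heI] at this
    convert this using 1
    have e1 : ∀ i, ((p i ++ (eT i : V) :: q i : List V) : Multiset V) =
        {(eT i : V)} + (p i : Multiset V) + (q i : Multiset V) := fun i => by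
      simp only [← Multiset.coe_add, ← Multiset.cons_coe, ← Multiset.singleton_add]
      abel
    rw [sum_congr rfl fun i _ => e1 i, sum_add_distrib, sum_add_distrib, hps, hqs,
      union_val_of_disjoint hd₂, union_val_of_disjoint hd₁,
      sum_equiv_coe eT fun v => ({v} : Multiset V), sum_multiset_singleton]

/-- A vertex set disjoint from two linkers, of the right size, is covered by linking paths. -/
theorem Joined.routes_of_linkers {m K j : ℕ} (hm : 0 < m) (hK : 0 < K) (hJ : Joined G m)
    (hj : 0 < j) (hmK : m ≤ K ^ j) {κ : Type*} [DecidableEq κ] {x y : κ → V}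
    (hx : Function.Injective x) (hy : Function.Injective y) {H L₁ L₂ s : ℕ}
    (hHdef : H = L₁ + 1 + L₂) (hH : 2 * j ≤ H) {S₁ S₂ B₁ B₂ U : Finset V}
    {I₁ I₂ I : Finset κ}
    (h₁ : Linker G x y H (H * ((K + 1) * m)) L₁ S₁ I₁ B₁)
    (h₂ : Linker G x y H (H * ((K + 1) * m)) L₂ S₂ I₂ B₂)
    (hS : Disjoint S₁ S₂) (hI : Disjoint I₁ I₂) (hI' : Disjoint (I₁ ∪ I₂) I)
    (hU : #U = H * (s + (K + 1) * m)) (hIc : #I = H * ((K + 1) * m) + s)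
    (hUd : ∀ v ∈ U, v ∉ S₁ ∪ S₂ ∪ (B₁ ∪ B₂))
    (hxU : ∀ i ∈ I, x i ∉ U ∪ (S₁ ∪ S₂) ∪ (B₁ ∪ B₂))
    (hyU : ∀ i ∈ I, y i ∉ U ∪ (S₁ ∪ S₂) ∪ (B₁ ∪ B₂)) :
    Routes G x y H (I₁ ∪ I₂ ∪ I) (S₁.val + S₂.val + U.val) := by
  have eU : Fin H × Fin (s + (K + 1) * m) ≃ U :=
    Fintype.equivOfCardEq (by simp [hU])
  -- Classes of one vertex (`t = 0`): the omitted vertex is the whole class, so no gadgets are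
  -- needed.
  set v : Fin H × Fin (s + (K + 1) * m) → Fin (0 + 1) → V := fun c _ => eU c with hv_def
  have hv : Function.Injective
      fun q : (Fin H × Fin (s + (K + 1) * m)) × Fin (0 + 1) => v q.1 q.2 := by
    intro q q' h
    exact Prod.ext (eU.injective (Subtype.ext h)) (Fin.ext (by omega))
  have hvU : univ.map ⟨_, hv⟩ = U := by
    refine eq_of_subset_of_card_le (fun w hw => ?_) (by simp [hU])
    obtain ⟨q, -, rfl⟩ := mem_map.1 hw
    exact (eU q.1).2
  have hl := hJ.exists_linker_compose hm hK hj hmK (S₀ := ∅) (I₀ := ∅) (β := (K + 1) * m) (t := 0)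
    hH (by omega) (Nat.mul_le_mul (by omega) (Nat.le_mul_of_pos_left m (by omega))) hHdef v hv (fun r => by
      simpa using Routes.empty) h₁ h₂ (fun c o h => hUd _ (eU c).2 (by simpa using h))
    (disjoint_empty_left _) (by simpa using hS) (disjoint_empty_left _) (by simpa using hI)
  rw [hvU, empty_union, empty_union] at hl
  have eI := (I.equivFinOfCardEq hIc).symm
  set e : Fin (H * ((K + 1) * m) + s) ↪ κ :=
    eI.toEmbedding.trans (Function.Embedding.subtype _) with he
  have heI : univ.map e = I := by
    refine eq_of_subset_of_card_le (fun k hk => ?_) (by simp [hIc])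
    obtain ⟨i, -, rfl⟩ := mem_map.1 hk
    exact (eI i).2
  have heI' : ∀ i, e i ∈ I := fun i => (eI i).2
  obtain ⟨p, hp, T, hT, hsum⟩ := hl.link (fun i => x (e i)) (fun i => y (e i))
    (hx.comp e.injective) (hy.comp e.injective) (fun i => hxU _ (heI' i)) (fun i => hyU _ (heI' i))
  have hp' := Routes.of_embedding (x := x) (y := y) e hp
  rw [heI] at hp'
  have := hT.union hp' hI'
  convert this using 1
  rw [add_comm T, hsum, union_val_of_disjoint (disjoint_left.2 fun w hw hw' =>
    hUd w hw (mem_union_left _ hw')), union_val_of_disjoint hS]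
  abel

set_option maxHeartbeats 2000000 in
/-- The path cover theorem for graphs of large minimum degree into `W` in which all sets of `m`
vertices are joined. -/
theorem Joined.routes [Fintype V] {m K j k H : ℕ} (hm : 0 < m) (hK : 0 < K) (hJ : Joined G m)
    (hj : 0 < j) (hj98 : 2 * j ≤ 98) (hmK : m ≤ K ^ j) {x y : Fin k → V}
    (hx : Function.Injective x) (hy : Function.Injective y) (hH : 198 ≤ H) {W : Finset V}
    (hxW : ∀ i, x i ∉ W) (hyW : ∀ i, y i ∉ W) (hW : #W = k * H)
    (hdeg : ∀ v, 40 * m * H ≤ #(nbrIn G W {v})) (hk : 100 * H * m * m ≤ k)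
    (hKm : H * (K + 1) ^ 2 ≤ m) : Routes G x y H univ W.val := by
  -- Size parameter `k` gives `#E ≤ 2 * k`, leaving at least `k * (H - 2)` vertices of `W` outside
  -- the reserve.
  obtain ⟨E, hEW, hEc, hE⟩ := hJ.exists_small_dense hdeg (k := k) (by
      nlinarith [Nat.mul_le_mul_right (m * m) hH, Nat.le_mul_of_pos_right m hm])
    (by rw [hW]; exact Nat.le_mul_of_pos_right _ (by omega))
  set T := H * H * m * m with hT
  clear_value T
  have hA : Avail G W E (40 * (m * H)) (50 * T) := by
    refine ⟨fun v => ?_, ?_⟩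
    · rw [inter_eq_right.2 hEW, ← mul_assoc]; exact hE v
    · rw [card_sdiff_of_subset hEW, hW]
      have e1 : k * H = 2 * k + k * (H - 2) := by
        obtain ⟨h, rfl⟩ : ∃ h, H = h + 2 := ⟨H - 2, by omega⟩
        simp; ring
      have e2 : 50 * T ≤ k * (H - 2) := by
        calc 50 * T = (50 * H * m * m) * H := by rw [hT]; ring
          _ ≤ (50 * H * m * m) * (2 * (H - 2)) := by gcongr; omega
          _ = (100 * H * m * m) * (H - 2) := by ring
          _ ≤ k * (H - 2) := by gcongr
      omega
  -- Single-vertex classes force `β = (K + 1) * m`, so each final linker must serve this many pairs.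
  set ρ := H * ((K + 1) * m) with hρ
  clear_value ρ
  -- The bound that keeps the composed linkers affordable: their `L * (s + m) * K` flexible pairs
  -- number at most `H * m * m`.
  have hρm : ρ * (K + 1) ≤ m * m := by
    calc ρ * (K + 1) = (H * (K + 1) ^ 2) * m := by rw [hρ]; ring
      _ ≤ m * m := by gcongr
  have hρm' : ρ ≤ m * m := (Nat.le_mul_of_pos_right _ (by omega)).trans hρm
  have hmm : m ≤ m * m := Nat.le_mul_of_pos_right _ hm
  have hmH : m ≤ m * H := Nat.le_mul_of_pos_right _ (by omega)
  have hT1 : 198 * (H * m * m) ≤ T := by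
    calc 198 * (H * m * m) ≤ H * (H * m * m) := by gcongr
      _ = T := by rw [hT]; ring
  have hT2 : 198 * (m * m) ≤ H * m * m := by
    rw [mul_assoc H]; gcongr
  have hT3 : m * H ≤ H * m * m := by
    calc m * H = H * m * 1 := by ring
      _ ≤ H * m * m := by gcongr; omega
  -- bounds for the linkers
  have hlink : ∀ (L : ℕ), 98 ≤ L → L + 1 ≤ H → ∀ (A : Finset V) (I : Finset (Fin k)),
      (∀ i, x i ∉ A) → 5 * (H * m * m) ≤ #I → Avail G A E (20 * (m * H)) (12 * T) →
      ∃ S ⊆ A, #(S ∩ E) ≤ 16 * (m * H) ∧ ∃ I' ⊆ I, #I' ≤ 5 * (H * m * m) ∧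
      ∃ B : Finset V, #B ≤ 12 * m ∧ Linker G x y H ρ L S I' B := by
    intro L hL hLH A I hxA hI hA
    have hLm : L * m ≤ ρ := by
      rw [hρ]
      calc L * m ≤ H * (1 * m) := by rw [one_mul]; gcongr; omega
        _ ≤ H * ((K + 1) * m) := by gcongr; omega
    obtain ⟨s, hs⟩ : ∃ s, ρ = L * m + s := ⟨ρ - L * m, by omega⟩
    have hsm : s + m ≤ ρ := by nlinarith
    have hIb : 4 * L * m * m + L * (s + m) * K ≤ 5 * (H * m * m) := by
      have e1 : L * (s + m) * K ≤ H * m * m := by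
        calc L * (s + m) * K ≤ H * ρ * (K + 1) := by gcongr <;> omega
          _ = H * (ρ * (K + 1)) := by ring
          _ ≤ H * (m * m) := by gcongr
          _ = H * m * m := by ring
      have e2 : 4 * L * m * m ≤ 4 * (H * m * m) := by
        calc 4 * L * m * m ≤ 4 * H * m * m := by gcongr; omega
          _ = 4 * (H * m * m) := by ring
      omega
    obtain ⟨S, hS, hSE, I', hI', hI'c, B, hB, hl⟩ := hJ.exists_linker hm hK hj hmK hx hy
      (H := H) (L := L) (L₁ := (L - 1) / 2) (L₂ := L - 1 - (L - 1) / 2) (s := s) (by omega)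
      (by omega) (by omega) (by omega) (by omega) (by omega) hxA I (hIb.trans hI)
      (E := E) ⟨fun v => le_trans (by nlinarith) (hA.deg v), le_trans (by
        have e1 : 10 * (L * m * m * H) ≤ 10 * T := by
          calc 10 * (L * m * m * H) ≤ 10 * (H * m * m * H) := by gcongr; omega
            _ = 10 * T := by rw [hT]; ring
        have e2 : 2 * (L * (s + m) * (K + 1) * H) ≤ 2 * T := by
          calc 2 * (L * (s + m) * (K + 1) * H) ≤ 2 * (H * ρ * (K + 1) * H) := by gcongr; omega
            _ = 2 * (H * H * (ρ * (K + 1))) := by ring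
            _ ≤ 2 * (H * H * (m * m)) := by gcongr
            _ = 2 * T := by rw [hT]; ring
        omega) hA.size⟩
    rw [← hs] at hl
    exact ⟨S, hS, hSE.trans (by nlinarith), I', hI', hI'c.trans hIb, B, hB, hl⟩
  have hSc : ∀ (S : Finset V) (I' : Finset (Fin k)) (L : ℕ), L ≤ H → #I' ≤ 5 * (H * m * m) →
      #S = ρ * L + #I' * H → #S ≤ 6 * T := by
    intro S I' L hL hI' hS
    have e1 : ρ * L ≤ T := by
      calc ρ * L ≤ (m * m) * H := by gcongr
        _ ≤ T := by nlinarith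
    have e2 : #I' * H ≤ 5 * T := by
      calc #I' * H ≤ 5 * (H * m * m) * H := by gcongr
        _ = 5 * T := by rw [hT]; ring
    omega
  obtain ⟨L₁, L₂, hHdef, hL₁, hL₂⟩ : ∃ L₁ L₂, H = L₁ + 1 + L₂ ∧ 98 ≤ L₁ ∧ 98 ≤ L₂ :=
    ⟨(H - 1) / 2, H - 1 - (H - 1) / 2, by omega, by omega, by omega⟩
  have hk' : 100 * (H * m * m) ≤ k := by
    calc 100 * (H * m * m) = 100 * H * m * m := by ring
      _ ≤ k := hk
  obtain ⟨S₁, hS₁, hS₁E, I₁, -, hI₁c, B₁, hB₁, hl₁⟩ := hlink L₁ hL₁ (by omega) W univ hxW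
    (by rw [card_univ, Fintype.card_fin]; omega)
    ⟨fun v => le_trans (by omega) (hA.deg v), le_trans (by omega) hA.size⟩
  have hS₁c := hSc S₁ I₁ L₁ (by omega) hI₁c hl₁.card
  have hA₁ : Avail G (W \ S₁) E (24 * (m * H)) (44 * T) :=
    hA.sdiff hS₁E hS₁c (by omega) (by omega)
  obtain ⟨S₂, hS₂, hS₂E, I₂, hI₂, hI₂c, B₂, hB₂, hl₂⟩ := hlink L₂ hL₂ (by omega) (W \ S₁)
    (univ \ I₁) (fun i hi => hxW i (sdiff_subset hi)) (by
      rw [card_sdiff_of_subset (subset_univ _), card_univ, Fintype.card_fin]; omega)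
    ⟨fun v => le_trans (by omega) (hA₁.deg v), le_trans (by omega) hA₁.size⟩
  have hS₂c := hSc S₂ I₂ L₂ (by omega) hI₂c hl₂.card
  have hA₂ : Avail G ((W \ S₁) \ S₂) E (8 * (m * H)) (38 * T) :=
    hA₁.sdiff hS₂E hS₂c (by omega) (by omega)
  -- covering the exceptional vertices
  set B := B₁ ∪ B₂ with hB
  have hBc : #B ≤ 24 * m := (card_union_le _ _).trans (by omega)
  have hI₁₂ : Disjoint I₁ I₂ := (disjoint_of_subset_left hI₂ sdiff_disjoint).symm
  have hS₁₂ : Disjoint S₁ S₂ := (disjoint_of_subset_left hS₂ sdiff_disjoint).symm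
  set J : Finset (Fin k) := univ \ (I₁ ∪ I₂) with hJdef
  have hJc : #J = k - (#I₁ + #I₂) := by
    rw [hJdef, card_sdiff_of_subset (subset_univ _), card_univ, Fintype.card_fin,
      card_union_of_disjoint hI₁₂]
  have hpre : ∀ f : Fin k → V, Function.Injective f → #{i ∈ J | f i ∈ B} ≤ 24 * m := by
    intro f hf
    rw [← card_image_of_injective _ hf]
    refine (card_le_card fun v hv => ?_).trans hBc
    obtain ⟨i, hi, rfl⟩ := mem_image.1 hv
    exact (mem_filter.1 hi).2
  -- Pairs with an endpoint in `B` (at most `48 * m`) and uncovered vertices of `B` (at most `24 *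
  -- m`) are both padded to `72 * m`, so that `Joined.exists_cover` can put one such vertex on each
  -- such path.
  obtain ⟨I₃, hI₃, hI₃J, hI₃c⟩ := exists_subsuperset_card_eq (n := 72 * m)
    (show {i ∈ J | x i ∈ B} ∪ {i ∈ J | y i ∈ B} ⊆ J from
      union_subset (filter_subset _ _) (filter_subset _ _))
    ((card_union_le _ _).trans (by have := hpre x hx; have := hpre y hy; omega)) (by omega)
  obtain ⟨T₃, hT₃, hT₃A, hT₃c⟩ := exists_subsuperset_card_eq (n := 72 * m)
    (show B ∩ ((W \ S₁) \ S₂) ⊆ (W \ S₁) \ S₂ from inter_subset_right)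
    ((card_le_card inter_subset_left).trans (by omega))
    (by have := hA₂.size; have := card_le_card (sdiff_subset (s := (W \ S₁) \ S₂) (t := E)); omega)
  have hH4 : 4 + (H - 4) = H := by omega
  obtain ⟨S₃, hS₃, hTS₃, hS₃c, hr₃⟩ := hJ.exists_cover hx hy (h := H - 4) (by omega) hT₃A hT₃c
    hI₃c (E := E) ⟨fun v => le_trans (by
        have : 4 * m * (3 + (H - 4)) ≤ 4 * (m * H) := by
          rw [mul_assoc]; gcongr; omega
        have : 198 * m ≤ m * H := by rw [mul_comm]; gcongr
        omega) (hA₂.deg v), le_trans (by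
        have : 2 * m * (3 + (H - 4)) ≤ 2 * (m * H) := by
          rw [mul_assoc]; gcongr; omega
        have : 72 * m * (4 + (H - 4)) = 72 * (m * H) := by rw [hH4]; ring
        have : 2 * m * m = 2 * (m * m) := by ring
        omega) hA₂.size⟩
  rw [hH4] at hS₃c hr₃
  -- the remaining vertices
  set U := ((W \ S₁) \ S₂) \ S₃ with hU
  set I := J \ I₃ with hI
  have hIc : #I = k - (#I₁ + #I₂) - 72 * m := by
    rw [hI, card_sdiff_of_subset hI₃J, hI₃c, hJc]
  obtain ⟨s, hs⟩ : ∃ s, #I = ρ + s := ⟨#I - ρ, by omega⟩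
  -- Beyond `H` vertices per pair already served, the linkers hold `ρ * (L₁ + L₂) = ρ * (H - 1)`
  -- vertices. Of the `(ρ + s) * H` owed to `I`, this leaves `s * H + ρ`, exactly the size that the
  -- levels require.
  have hUc : #U = H * (s + (K + 1) * m) := by
    have e1 : #W = #S₁ + #S₂ + #S₃ + #U := by
      have h1 := card_sdiff_add_card_eq_card hS₁
      have h2 := card_sdiff_add_card_eq_card hS₂
      have h3 := card_sdiff_add_card_eq_card hS₃
      rw [← hU] at h3
      omega
    have e2 : k = #I₁ + #I₂ + 72 * m + (ρ + s) := by omega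
    rw [hW, hl₁.card, hl₂.card, hS₃c] at e1
    have e3 : ρ * L₁ + ρ * L₂ + ρ = ρ * H := by rw [hHdef]; ring
    have e4 : k * H = #I₁ * H + #I₂ * H + 72 * m * H + (ρ * H + s * H) := by
      conv_lhs => rw [e2]
      ring
    have e5 : H * (s + (K + 1) * m) = s * H + ρ := by rw [hρ]; ring
    omega
  have hmemI : ∀ i ∈ I, i ∈ J ∧ i ∉ I₃ := fun i hi => mem_sdiff.1 hi
  have havoid : ∀ (f : Fin k → V), (∀ i, f i ∉ W) → (∀ i ∈ J, f i ∈ B → i ∈ I₃) →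
      ∀ i ∈ I, f i ∉ U ∪ (S₁ ∪ S₂) ∪ B := by
    intro f hf hfB i hi h
    rcases mem_union.1 h with h | h
    · refine hf i ?_
      rcases mem_union.1 h with h | h
      · exact sdiff_subset (sdiff_subset (sdiff_subset h))
      · rcases mem_union.1 h with h | h
        · exact hS₁ h
        · exact sdiff_subset (hS₂ h)
    · exact (hmemI i hi).2 (hfB i (hmemI i hi).1 h)
  subst hρ
  have hr := hJ.routes_of_linkers hm hK hj hmK hx hy hHdef (by omega) hl₁ hl₂ hS₁₂
    hI₁₂ (I := I) (U := U) (s := s) (by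
      refine disjoint_of_subset_right sdiff_subset ?_
      rw [hJdef]; exact disjoint_sdiff) hUc hs
    (fun v hv h => by
      simp only [hU, mem_sdiff] at hv
      rcases mem_union.1 h with h | h
      · rcases mem_union.1 h with h | h
        · exact hv.1.1.2 h
        · exact hv.1.2 h
      · exact hv.2 (hTS₃ (hT₃ (mem_inter.2 ⟨h, by simp only [mem_sdiff]; tauto⟩))))
    (havoid x hxW fun i hi h => hI₃ (mem_union_left _ (mem_filter.2 ⟨hi, h⟩)))
    (havoid y hyW fun i hi h => hI₃ (mem_union_right _ (mem_filter.2 ⟨hi, h⟩)))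
  have hfin := hr.union hr₃ (disjoint_left.2 fun i hi hi3 => by
    rcases mem_union.1 hi with h | h
    · exact (mem_sdiff.1 (hI₃J hi3)).2 h
    · exact (hmemI i h).2 hi3)
  have e1 : I₁ ∪ I₂ ∪ I ∪ I₃ = univ := by
    rw [union_assoc, hI, sdiff_union_of_subset hI₃J, hJdef, union_sdiff_of_subset (subset_univ _)]
  have e2 : S₁.val + S₂.val + U.val + S₃.val = W.val := by
    have h1 := union_val_of_disjoint (disjoint_sdiff (s := S₁) (t := W))
    have h2 := union_val_of_disjoint (disjoint_sdiff (s := S₂) (t := W \ S₁))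
    have h3 := union_val_of_disjoint (disjoint_sdiff (s := S₃) (t := (W \ S₁) \ S₂))
    rw [union_sdiff_of_subset hS₁] at h1
    rw [union_sdiff_of_subset hS₂] at h2
    rw [union_sdiff_of_subset hS₃] at h3
    rw [h1, h2, h3]
    abel
  rwa [e1, e2] at hfin

/-! ### From links to paths -/

theorem IsLink.exists_walk {a b : V} {L : ℕ} {p : List V} (h : IsLink G a b L p) :
    ∃ w : G.Walk a b, w.support = a :: (p ++ [b]) := by
  obtain ⟨-, h⟩ := h
  induction p generalizing a with
  | nil =>
    simp only [List.nil_append, List.isChain_cons_cons, List.isChain_singleton, and_true] at h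
    exact ⟨h.toWalk, by simp⟩
  | cons c p ih =>
    simp only [List.cons_append, List.isChain_cons_cons] at h
    obtain ⟨w, hw⟩ := ih h.2
    exact ⟨w.cons h.1, by simp [hw]⟩

/-- Disjoint links covering `W` are disjoint paths covering everything. -/
theorem Routes.exists_paths {k H : ℕ} {x y : Fin k → V} {W : Finset V}
    (hr : Routes G x y H univ W.val) (hxy : Function.Injective (Sum.elim x y))
    (hxW : ∀ i, x i ∉ W) (hyW : ∀ i, y i ∉ W) (hcov : ∀ v ∉ W, ∃ i, v = x i ∨ v = y i) :
    ∃ P : ∀ i : Fin k, G.Walk (x i) (y i),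
      (∀ i, (P i).IsPath ∧ (P i).length = H + 1) ∧
      (∀ i j, i ≠ j → (P i).support.Disjoint (P j).support) ∧
      ∀ v : V, ∃ i, v ∈ (P i).support := by
  obtain ⟨r, hr, hsum⟩ := hr
  choose P hP using fun i => (hr i (mem_univ i)).exists_walk
  have hrW : ∀ i v, v ∈ r i → v ∈ W := fun i v hv => mem_of_sum_eq hsum hv
  have hne : ∀ i j, x i ≠ y j := fun i j h => by
    simpa using hxy (a₁ := Sum.inl i) (a₂ := Sum.inr j) h
  have hx : Function.Injective x := fun i j h => by
    simpa using hxy (a₁ := Sum.inl i) (a₂ := Sum.inl j) h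
  have hy : Function.Injective y := fun i j h => by
    simpa using hxy (a₁ := Sum.inr i) (a₂ := Sum.inr j) h
  refine ⟨P, fun i => ⟨?_, ?_⟩, fun i j hij v hi hj => ?_, fun v => ?_⟩
  · rw [SimpleGraph.Walk.isPath_def, hP, List.nodup_cons, List.nodup_append]
    refine ⟨?_, nodup_of_sum_eq hsum i, by simp, ?_⟩
    · simp only [List.mem_append, List.mem_singleton, not_or]
      exact ⟨fun h => hxW i (hrW i _ h), hne i i⟩
    · intro v hv w hw h
      rw [List.mem_singleton] at hw
      exact hyW i (hw ▸ h ▸ hrW i v hv)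
  · have h := SimpleGraph.Walk.length_support (P i)
    rw [hP] at h
    simp only [List.length_cons, List.length_append, (hr i (mem_univ i)).1] at h
    simpa using h.symm
  · rw [hP] at hi hj
    simp only [List.mem_cons, List.mem_append, List.not_mem_nil, or_false] at hi hj
    rcases hi with rfl | hi | rfl
    · rcases hj with h | h | h
      · exact hij (hx h)
      · exact hxW i (hrW j _ h)
      · exact hne i j h
    · rcases hj with rfl | h | rfl
      · exact hxW j (hrW i _ hi)
      · exact hij (eq_of_sum_eq hsum hi h)
      · exact hyW j (hrW i _ hi)
    · rcases hj with h | h | h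
      · exact hne j i h.symm
      · exact hyW i (hrW j _ h)
      · exact hij (hy h)
  · by_cases hv : v ∈ W
    · rw [← mem_val, ← hsum, Multiset.mem_sum] at hv
      obtain ⟨i, -, hi⟩ := hv
      exact ⟨i, by rw [hP]; simp [Multiset.mem_coe.1 hi]⟩
    · obtain ⟨i, h | h⟩ := hcov v hv
      · exact ⟨i, by rw [hP]; simp [h]⟩
      · exact ⟨i, by rw [hP]; simp [h]⟩

/-! ### Numerical choices -/

/-- `K` is the integer fourth root of `m` plus one: large enough for four levels to suffice, yet
with square of order √m, so that the factor `H` is absorbed for large `m`. -/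
theorem exists_fourth_root_bound (H : ℕ) :
    ∃ m₀, 2 ≤ m₀ ∧ ∀ m, m₀ ≤ m → ∃ K, 0 < K ∧ m ≤ K ^ 4 ∧ H * (K + 1) ^ 2 ≤ m := by
  refine ⟨(4 * H + 2) ^ 4, ?_, fun m hm => ⟨m.sqrt.sqrt + 1, by omega, ?_, ?_⟩⟩
  · exact le_trans (by omega) (Nat.le_self_pow (by omega) _)
  · have h1 := Nat.lt_succ_sqrt m
    have h2 := Nat.lt_succ_sqrt m.sqrt
    simp only [Nat.succ_eq_add_one] at h1 h2
    calc m ≤ (m.sqrt + 1) * (m.sqrt + 1) := h1.le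
      _ ≤ ((m.sqrt.sqrt + 1) * (m.sqrt.sqrt + 1)) * ((m.sqrt.sqrt + 1) * (m.sqrt.sqrt + 1)) :=
        Nat.mul_le_mul h2 h2
      _ = (m.sqrt.sqrt + 1) ^ 4 := by ring
  · have h1 : 4 * H + 2 ≤ m.sqrt.sqrt := by
      rw [Nat.le_sqrt, Nat.le_sqrt]
      calc _ = (4 * H + 2) ^ 4 := by ring
        _ ≤ m := hm
    have h2 := Nat.sqrt_le m
    have h3 := Nat.sqrt_le m.sqrt
    set a := m.sqrt.sqrt
    calc H * (a + 1 + 1) ^ 2 ≤ H * (2 * a) ^ 2 := by gcongr; omega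
      _ = 4 * H * (a * a) := by ring
      _ ≤ (a * a) * (a * a) := Nat.mul_le_mul_right _ (by nlinarith)
      _ ≤ m.sqrt * m.sqrt := Nat.mul_le_mul h3 h3
      _ ≤ m := h2

/-- Here `s` plays √n and `w` plays |W|. The quotient is at most `s / (20 * l)`, and half of `s`
pays for the rounding. -/
theorem ceil_div_bounds {l s k w : ℝ} {m₀ : ℕ} (hl : 200 ≤ l) (hm₀ : 2 ≤ m₀)
    (hs : 40 * l * m₀ ≤ s) (hs2 : s * s = l * k) (hw : w = k * (l - 2)) :
    m₀ ≤ ⌈w / (2 * (10 * l * s))⌉₊ ∧ 10 * l * ⌈w / (2 * (10 * l * s))⌉₊ ≤ s := by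
  have hm : (2 : ℝ) ≤ m₀ := by exact_mod_cast hm₀
  have hl0 : 0 < l := by linarith
  have hs3 : 80 * l ≤ s := le_trans (by nlinarith) hs
  have hs0 : 0 < s := by linarith
  have hk : 0 < k := pos_of_mul_pos_right (hs2 ▸ mul_pos hs0 hs0) hl0.le
  constructor
  · have h : (m₀ : ℝ) ≤ w / (2 * (10 * l * s)) := by
      rw [le_div_iff₀ (by positivity), hw]
      refine le_of_mul_le_mul_left ?_ hl0
      calc l * (m₀ * (2 * (10 * l * s))) = 40 * l * m₀ * (l / 2 * s) := by ring
        _ ≤ s * (l / 2 * s) := by gcongr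
        _ = s * s * (l / 2) := by ring
        _ ≤ s * s * (l - 2) := by gcongr; linarith
        _ = l * (k * (l - 2)) := by rw [hs2]; ring
    exact_mod_cast h.trans (Nat.le_ceil _)
  · have hw0 : 0 ≤ w := hw ▸ mul_nonneg hk.le (by linarith)
    have h1 : w / (2 * (10 * l * s)) ≤ s / (20 * l) := by
      rw [div_le_div_iff₀ (by positivity) (by positivity)]
      calc w * (20 * l) ≤ s * s * (20 * l) := by gcongr; linarith
        _ = s * (2 * (10 * l * s)) := by ring
    have h2 := Nat.ceil_lt_add_one (show 0 ≤ w / (2 * (10 * l * s)) by positivity)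
    calc 10 * l * ⌈w / (2 * (10 * l * s))⌉₊ ≤ 10 * l * (s / (20 * l) + 1) := by
          gcongr; linarith
      _ = s / 2 + 10 * l := by field_simp; ring
      _ ≤ s := by linarith

end PathCover

/-! ### Deduction from expansion -/

namespace SimpleGraph

open Finset PathCover

variable {V : Type*} [Fintype V] [DecidableEq V] {G : SimpleGraph V} [DecidableRel G.Adj]

theorem ExpandsInto.joined_ceil {d : ℝ} {W : Finset V} (h : G.ExpandsInto d W) :
    Joined G ⌈(#W : ℝ) / (2 * d)⌉₊ := by
  intro X Y hXY hX hY
  obtain ⟨X', hX', hXc⟩ := exists_subset_card_eq hX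
  obtain ⟨Y', hY', hYc⟩ := exists_subset_card_eq hY
  obtain ⟨e, he⟩ := card_pos.1 (h.joined X' Y' (hXY.mono hX' hY') hXc hYc)
  obtain ⟨u, v⟩ := e
  rw [mem_interedges_iff] at he
  exact ⟨u, hX' he.1, v, hY' he.2.1, he.2.2⟩

/-- Only the singleton case of the expansion condition is needed; it applies once the threshold
exceeds one. -/
theorem ExpandsInto.le_card_nbrIn {d : ℝ} {W : Finset V} (h : G.ExpandsInto d W)
    (hW : 1 < ⌈(#W : ℝ) / (2 * d)⌉₊) (v : V) : d ≤ #(nbrIn G W {v}) := by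
  have h1 := h.expand {v} (by simp) (by simpa using hW)
  rw [card_singleton, Nat.cast_one, mul_one] at h1
  refine h1.trans (Nat.cast_le.2 (card_le_card fun w hw => ?_))
  simp only [extNeighborFinset, mem_inter, mem_sdiff, mem_biUnion, mem_singleton,
    exists_eq_left, mem_neighborFinset] at hw
  exact mem_nbrIn.2 ⟨hw.2, v, mem_singleton_self v, hw.1.1⟩

end SimpleGraph

open PathCover in
theorem mainTheorem5 :
    ∃ C : ℝ, 0 < C ∧ ∀ ℓ : ℕ, 200 ≤ ℓ → ∃ n₀ : ℕ, ∀ n : ℕ, n₀ ≤ n → ℓ ∣ n →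
      ∀ (V : Type*) [Fintype V] [DecidableEq V] (G : SimpleGraph V) [DecidableRel G.Adj],
        Fintype.card V = n →
        ∀ x y : Fin (n / ℓ) → V, Function.Injective (Sum.elim x y) →
          G.ExpandsInto (C * (ℓ : ℝ) * Real.sqrt (n : ℝ))
            (Finset.univ \ Finset.univ.biUnion (fun i => {x i, y i})) →
          ∃ P : ∀ i : Fin (n / ℓ), G.Walk (x i) (y i),
            (∀ i, (P i).IsPath ∧ (P i).length = ℓ - 1) ∧
            (∀ i j, i ≠ j → (P i).support.Disjoint (P j).support) ∧
            (∀ v : V, ∃ i, v ∈ (P i).support) := by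
  refine ⟨10, by norm_num, fun ℓ hℓ => ?_⟩
  obtain ⟨m₀, hm₀, hroot⟩ := exists_fourth_root_bound (ℓ - 2)
  -- This forces √n ≥ 40ℓm₀, hence m ≥ m₀.
  refine ⟨(40 * ℓ * m₀) ^ 2, fun n hn hdvd V _ _ G _ hV x y hxy hG => ?_⟩
  obtain ⟨H, rfl⟩ : ∃ H, ℓ = H + 2 := ⟨ℓ - 2, by omega⟩
  simp only [Nat.add_sub_cancel] at hroot
  obtain ⟨k, rfl⟩ := hdvd
  set W : Finset V := Finset.univ \ Finset.univ.biUnion (fun i => {x i, y i}) with hW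
  have hmemW : ∀ v, v ∉ W ↔ ∃ i, v = x i ∨ v = y i := fun v => by
    simp [hW, or_iff_not_imp_left]
  have hxW : ∀ i, x i ∉ W := fun i => (hmemW _).2 ⟨i, Or.inl rfl⟩
  have hyW : ∀ i, y i ∉ W := fun i => (hmemW _).2 ⟨i, Or.inr rfl⟩
  have hk : (H + 2) * k / (H + 2) = k := Nat.mul_div_cancel_left k (by omega)
  have hWc : W.card = (H + 2) * k / (H + 2) * H := by
    have h1 : Wᶜ = Finset.univ.map ⟨_, hxy⟩ := by
      ext v
      rw [Finset.mem_compl, hmemW]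
      simp [eq_comm, exists_or]
    have h2 := Finset.card_compl W
    rw [h1, Finset.card_map, Finset.card_univ, hV] at h2
    simp only [Fintype.card_sum, Fintype.card_fin] at h2
    have h3 : W.card ≤ (H + 2) * k := hV ▸ Finset.card_le_univ W
    rw [hk] at h2 ⊢
    have h4 : (H + 2) * k = k * H + 2 * k := by ring
    omega
  have hl : (200 : ℝ) ≤ ((H + 2 : ℕ) : ℝ) := by exact_mod_cast hℓ
  have hs1 : 40 * ((H + 2 : ℕ) : ℝ) * m₀ ≤ Real.sqrt (((H + 2) * k : ℕ) : ℝ) :=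
    Real.le_sqrt_of_sq_le (by exact_mod_cast hn)
  have hs0 := Real.sqrt_nonneg (((H + 2) * k : ℕ) : ℝ)
  have hs2 : Real.sqrt (((H + 2) * k : ℕ) : ℝ) * Real.sqrt (((H + 2) * k : ℕ) : ℝ) =
      ((H + 2 : ℕ) : ℝ) * k := by
    rw [Real.mul_self_sqrt (Nat.cast_nonneg _), Nat.cast_mul]
  have hH : (H : ℝ) = ((H + 2 : ℕ) : ℝ) - 2 := by push_cast; ring
  have hWr : (W.card : ℝ) = k * (((H + 2 : ℕ) : ℝ) - 2) := by
    rw [hWc, hk, ← hH, Nat.cast_mul]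
  generalize Real.sqrt (((H + 2) * k : ℕ) : ℝ) = s at *
  generalize ((H + 2 : ℕ) : ℝ) = l at *
  obtain ⟨hm0, hup⟩ := ceil_div_bounds hl hm₀ hs1 hs2 hWr
  have hl0 : 0 < l := by linarith
  have hJ := hG.joined_ceil
  have hdeg := hG.le_card_nbrIn
  generalize ⌈(W.card : ℝ) / (2 * (10 * l * s))⌉₊ = m at *
  obtain ⟨K, hK, hmK, hKm⟩ := hroot m hm0
  -- `j := 4` matches the fourth root. Squaring 10ℓm ≤ √n yields 100ℓm² ≤ k, the supply of pairs for
  -- the linkers.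
  have hr := hJ.routes (j := 4) (K := K) (by omega) hK (by omega) (by omega) hmK
    (fun i j h => by simpa using hxy (a₁ := Sum.inl i) (a₂ := Sum.inl j) h)
    (fun i j h => by simpa using hxy (a₁ := Sum.inr i) (a₂ := Sum.inr j) h)
    (by omega) hxW hyW hWc (fun v => by
      have h1 := hdeg (by omega) v
      have h2 : ((40 * m * H : ℕ) : ℝ) ≤ 10 * l * s := by
        push_cast
        rw [hH]
        calc 40 * (m : ℝ) * (l - 2) ≤ 40 * m * l := by gcongr; linarith
          _ = 4 * (10 * l * m) := by ring
          _ ≤ 4 * s := by gcongr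
          _ ≤ 10 * l * s := by gcongr; linarith
      exact_mod_cast h2.trans h1) (by
      rw [hk]
      have h1 : (10 * l * m) * (10 * l * m) ≤ l * k := by
        rw [← hs2]
        exact mul_le_mul hup hup (by positivity) hs0
      have h2 : ((100 * H * m * m : ℕ) : ℝ) ≤ k := by
        push_cast
        rw [hH]
        refine le_of_mul_le_mul_left ?_ hl0
        calc l * (100 * (l - 2) * m * m) ≤ l * (100 * l * m * m) := by gcongr; linarith
          _ = (10 * l * m) * (10 * l * m) := by ring
          _ ≤ l * k := h1
      exact_mod_cast h2) hKm
  obtain ⟨P, h1, h2, h3⟩ := hr.exists_paths hxy hxW hyW fun v hv => (hmemW v).1 hv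
  exact ⟨P, fun i => ⟨(h1 i).1, by rw [(h1 i).2]; omega⟩, h2, h3⟩
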